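/- Write $\hat f(t)=\int_{-\infty}^{\infty}e^{-itx}f(x)\,dx$, and let $A_c(\mathbb R)$ be the set of compactly supported functions $\varphi:\mathbb R\to\mathbb C$ of the form $\varphi=\hat f$ with $f\in L^1(\mathbb R)$. A function $S:[0,\infty)\to\mathbb R$ is called log-linearly slowly decreasing if for every $\varepsilon>0$ there are $\delta>0$ and $x_0$ such that $\frac{S(x+h)-S(x)}{e^{x}}\ge-\varepsilon$ for all $x\ge x_0$ and $0\le h\le\delta$. For $a\in\mathbb R$, $S(x)\sim ae^x$ means $\lim_{x\to\infty}e^{-x}S(x)=a$ (also when $a=0$). Let $S:[0,\infty)\to\mathbb R$ be locally integrable on $[0,\infty)$, let $a\in\mathbb R$, and let $\varphi\in A_c(\mathbb R)$ be non-identically zero with $\hat\varphi(x)\ge 0$ for all $x\in\mathbb R$. Then $S(x)\sim ae^x$ if and only if the following three conditions hold: (i) $S$ is log-linearly slowly decreasing; (ii) the (improper) integral $\mathcal L\{S;s\}=\int_0^\infty e^{-sx}S(x)\,dx$ converges for every $s$ with $\operatorname{Re}s>1$; (iii) with $G(s)=\mathcal L\{S;s\}-\frac{a}{s-1}$, there is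 $\lambda_0>0$ such that for each $\lambda\ge\lambda_0$ the limit $$I_\lambda(h)=\lim_{\sigma\to1^+}\int_{-\infty}^{\infty}G(\sigma+it)\,e^{iht}\,\varphi\!\left(\frac t\lambda\right)dt$$ exists for all sufficiently large $h$ (that is, for all $h>h_\lambda$, for some $h_\lambda$ depending on $\lambda$), and $\lim_{h\to\infty}I_\lambda(h)=0$. Moreover, the function $\varphi(t)=\chi_{[-1,1]}(t)(1-|t|)$ belongs to $A_c(\mathbb R)$, is not identically zero and has non-negative Fourier transform, and the corresponding special case (the exact form of Zhang's theorem) holds: for $S$ and $a$ as above, $S(x)\sim ae^x$ if and only if (i) holds, the integral $\mathcal L\{S;s\}$ converges absolutely for $\operatorname{Re}s>1$, and there is $\lambda_0>0$ such that for each $\lambda\ge\lambda_0$ the limit $$I_\lambda(h)=\lim_{\sigma\to1^+}\int_{-\lambda}^{\lambda}G(\sigma+it)\,e^{iht}\left(1-\frac{|t|}\lambda\right)dt$$ exists for all sufficiently large $h$, and $\lim_{h\to\infty}I_\lambda(h)=0$. -/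

import Mathlib

open Filter Topology MeasureTheory Set

noncomputable section

/-- The Fourier transform with the normalization `∫ e^{-itx} f(x) dx`. -/
def angularFourier (f : ℝ → ℂ) (t : ℝ) : ℂ :=
  ∫ x : ℝ, Complex.exp (-(Complex.I * (t : ℂ) * (x : ℂ))) * f x

/-- The Wiener algebra `A(ℝ) = F(L¹(ℝ))`. -/
def MemWienerAlgebra (φ : ℝ → ℂ) : Prop :=
  ∃ f : ℝ → ℂ, Integrable f ∧ φ = angularFourier f

/-- The compactly supported members of the Wiener algebra. -/
def MemWienerAlgebraCompact (φ : ℝ → ℂ) : Prop :=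
  MemWienerAlgebra φ ∧ HasCompactSupport φ

/-- The Fourier transform of `φ` takes values in `[0, ∞)`. -/
def NonnegFourier (φ : ℝ → ℂ) : Prop :=
  ∀ x : ℝ, 0 ≤ (angularFourier φ x).re ∧ (angularFourier φ x).im = 0

/-- Log-linear slow decrease. -/
def LogLinearlySlowlyDecreasing (S : ℝ → ℝ) : Prop :=
  ∀ ε : ℝ, 0 < ε → ∃ δ : ℝ, 0 < δ ∧ ∃ x₀ : ℝ, ∀ x : ℝ, x₀ ≤ x → ∀ h : ℝ, 0 ≤ h → h ≤ δ →
    -ε ≤ (S (x + h) - S x) / Real.exp x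

/-- The truncated Laplace integral `∫_0^X e^{-sx} S(x) dx`. -/
def laplacePartial (S : ℝ → ℝ) (s : ℂ) (X : ℝ) : ℂ :=
  ∫ x in (0 : ℝ)..X, Complex.exp (-(s * (x : ℂ))) * (S x : ℂ)

/-- Convergence, possibly conditional, of the improper Laplace integral at `s`. -/
def LaplaceConvergesAt (S : ℝ → ℝ) (s : ℂ) : Prop :=
  ∃ L : ℂ, Tendsto (laplacePartial S s) atTop (𝓝 L)

/-- The Laplace transform as an improper integral (meaningful where it converges). -/
def laplaceTransform (S : ℝ → ℝ) (s : ℂ) : ℂ :=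
  limUnder atTop (laplacePartial S s)

/-- The function `G(s) = L{S; s} - a / (s - 1)`. -/
def laplaceMinusPole (S : ℝ → ℝ) (a : ℝ) (s : ℂ) : ℂ :=
  laplaceTransform S s - (a : ℂ) / (s - 1)

/-- The Fejér multiplier `(1 - |t|) χ_{[-1,1]}(t)`. -/
def fejerMultiplier (t : ℝ) : ℂ :=
  (Icc (-1 : ℝ) 1).indicator (fun u : ℝ => ((1 - |u| : ℝ) : ℂ)) t

end

/-! Put r(x) = e^{-x}S(x) - a and F = φ̂. By Fubini, the smoothed integral of G over the line Re s =
σ equals ∫_0^∞ e^{-(σ-1)x} r(x) λF(λ(x-h)) dx (`integral_laplaceMinusPole`). Since F is continuous,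
integrable, nonnegative and not zero, the kernel has a fixed positive mass, and as λ grows this mass
concentrates near h. Condition (iii) thus says that these Abel means have limits as σ → 1 and that
the limits vanish as h → ∞.

If r → 0, domination gives all the conditions.

For the converse, slow decrease bounds r from below. The one-sided bound makes the Laplace integral
absolutely convergent and, by a Fatou argument, lets σ → 1 pass under the integral sign
(`tendsto_integral_of_abel`), so the convolutions of r with the kernel tend to 0. A large value of r
would persist to its right and make a convolution large, so r is also bounded above
(`exists_upper_bound`). Then r is bounded and slowly decreasing in the ordinary sense. A value of r
away from 0 forces the same sign and size on a short one-sided window; for λ large nearly all the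
kernel mass lies there, a contradiction (`tendsto_zero_of_slowlyDecreasing`). -/

section

open scoped FourierTransform ContDiff

/-! ### Fourier inversion and the kernel of an admissible multiplier. -/

/-- Self-adjointness of the Fourier transform for the bilinear pairing. -/
theorem integral_fourier_mul_eq {f g : ℝ → ℂ} (hf : Integrable f) (hg : Integrable g) :
    ∫ x, 𝓕 f x * g x = ∫ x, f x * 𝓕 g x := by
  simpa using! (VectorFourier.integral_fourierIntegral_smul_eq_flip (L := innerₗ ℝ)
    Real.continuous_fourierChar continuous_inner hf hg)

theorem continuous_fourier {f : ℝ → ℂ} (hf : Integrable f) : Continuous (𝓕 f) :=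
  VectorFourier.fourierIntegral_continuous Real.continuous_fourierChar
    (L := innerₗ ℝ) continuous_inner hf

theorem continuous_fourierInv {f : ℝ → ℂ} (hf : Integrable f) : Continuous (𝓕⁻ f) := by
  have h : 𝓕⁻ f = fun x => 𝓕 f (-x) := by
    funext x
    exact Real.fourierInv_eq_fourier_neg f x
  rw [h]
  exact (continuous_fourier hf).comp continuous_neg

/-- Fourier inversion almost everywhere, without a continuity assumption. -/
theorem fourierInv_fourier_ae_eq {f : ℝ → ℂ} (hf : Integrable f) (hf' : Integrable (𝓕 f)) :
    𝓕⁻ (𝓕 f) =ᵐ[volume] f := by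
  refine ae_eq_of_integral_contDiff_smul_eq
    (continuous_fourierInv hf').locallyIntegrable hf.locallyIntegrable ?_
  intro g hg hgs
  let k : ℝ → ℂ := fun x => (g x : ℂ)
  have hks : HasCompactSupport k := hgs.comp_left (g := fun r : ℝ => (r : ℂ)) (by simp)
  have hk : ContDiff ℝ ∞ k := Complex.ofRealCLM.contDiff.comp hg
  -- Viewing the test function as a Schwartz function makes its transforms integrable, so both
  -- transforms can be moved from f onto it and cancelled there.
  let K := hks.toSchwartzMap hk
  have hKi : Integrable k := K.integrable
  have hKF : Integrable (𝓕⁻ k) := by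
    have h := (𝓕⁻ K).integrable (μ := volume)
    rwa [show ((𝓕⁻ K : SchwartzMap ℝ ℂ) : ℝ → ℂ) = 𝓕⁻ k from SchwartzMap.fourierInv_coe K] at h
  have hKF2 : Integrable (𝓕 k) := by
    have h := (𝓕 K).integrable (μ := volume)
    rwa [show ((𝓕 K : SchwartzMap ℝ ℂ) : ℝ → ℂ) = 𝓕 k from SchwartzMap.fourier_coe K] at h
  have hinv : 𝓕 (𝓕⁻ k) = k := hk.continuous.fourier_fourierInv_eq hKi hKF2
  calc ∫ x, g x • 𝓕⁻ (𝓕 f) x = ∫ x, 𝓕 (𝓕 f) (-x) * k x := by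
        refine integral_congr_ae (.of_forall fun x => ?_)
        simp [k, Real.fourierInv_eq_fourier_neg, mul_comm]
    _ = ∫ x, 𝓕 (𝓕 f) x * k (-x) := by
        rw [← integral_neg_eq_self]
        simp
    _ = ∫ x, 𝓕 f x * 𝓕⁻ k x := by
        rw [integral_fourier_mul_eq hf' hKi.comp_neg, Real.fourierInv_eq_fourier_comp_neg]
    _ = ∫ x, f x * k x := by rw [integral_fourier_mul_eq hf hKF, hinv]
    _ = ∫ x, g x • f x := by
        refine integral_congr_ae (.of_forall fun x => ?_)
        simp [k, mul_comm]

theorem angularFourier_eq_fourier (f : ℝ → ℂ) (t : ℝ) :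
    angularFourier f t = 𝓕 f (t / (2 * Real.pi)) := by
  rw [Real.fourier_real_eq_integral_exp_smul, angularFourier]
  refine integral_congr_ae (.of_forall fun x => ?_)
  simp only [smul_eq_mul]
  congr 2
  have : (Real.pi : ℂ) ≠ 0 := by exact_mod_cast Real.pi_ne_zero
  push_cast
  field_simp

theorem continuous_angularFourier {f : ℝ → ℂ} (hf : Integrable f) :
    Continuous (angularFourier f) := by
  rw [show angularFourier f = fun t => 𝓕 f (t / (2 * Real.pi)) from
    funext (angularFourier_eq_fourier f)]
  exact (continuous_fourier hf).comp (by fun_prop)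

theorem tendsto_angularFourier_cocompact (f : ℝ → ℂ) :
    Tendsto (angularFourier f) (cocompact ℝ) (𝓝 0) := by
  rw [show angularFourier f = fun t => 𝓕 f (t / (2 * Real.pi)) from
    funext (angularFourier_eq_fourier f)]
  refine (Real.zero_at_infty_fourier f).comp ?_
  have h : (2 * Real.pi) ≠ 0 := by positivity
  exact (Homeomorph.mulRight₀ _ (inv_ne_zero h)).isClosedEmbedding.tendsto_cocompact

/-- Substitution t = 2πy. The right side keeps 𝓕⁻(𝓕 f) because inversion is available only a.e. or
under continuity, depending on f. -/
theorem angularFourier_angularFourier (f : ℝ → ℂ) (x : ℝ) :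
    angularFourier (angularFourier f) x = 2 * Real.pi * 𝓕⁻ (𝓕 f) (-x) := by
  rw [Real.fourierInv_eq_fourier_neg, neg_neg, Real.fourier_real_eq_integral_exp_smul,
    angularFourier]
  have hpi : (2 * Real.pi) ≠ 0 := by positivity
  have h := Measure.integral_comp_div
    (fun y : ℝ => Complex.exp (↑(-2 * Real.pi * y * x) * Complex.I) • 𝓕 f y) (2 * Real.pi)
  rw [abs_of_pos (by positivity), Complex.real_smul] at h
  push_cast at h
  push_cast
  rw [← h]
  refine integral_congr_ae (.of_forall fun t => ?_)
  simp only [smul_eq_mul, angularFourier_eq_fourier]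
  congr 2
  have : (Real.pi : ℂ) ≠ 0 := by exact_mod_cast Real.pi_ne_zero
  field_simp

theorem MemWienerAlgebraCompact.integrable {φ : ℝ → ℂ} (h : MemWienerAlgebraCompact φ) :
    Integrable φ := by
  obtain ⟨⟨f, hf, rfl⟩, hs⟩ := h
  exact (continuous_angularFourier hf).integrable_of_hasCompactSupport hs

theorem MemWienerAlgebraCompact.continuous {φ : ℝ → ℂ} (h : MemWienerAlgebraCompact φ) :
    Continuous φ := by
  obtain ⟨⟨f, hf, rfl⟩, hs⟩ := h
  exact continuous_angularFourier hf

/-- The Fourier transform of a compactly supported member of the Wiener algebra is integrable. -/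
theorem MemWienerAlgebraCompact.integrable_angularFourier {φ : ℝ → ℂ}
    (h : MemWienerAlgebraCompact φ) : Integrable (angularFourier φ) := by
  have hi := h.integrable
  obtain ⟨⟨f, hf, rfl⟩, hs⟩ := h
  have hpi : (2 * Real.pi) ≠ 0 := by positivity
  have hF : Integrable (𝓕 f) := by
    have := hi.comp_mul_right' hpi
    refine this.congr (.of_forall fun t => ?_)
    simp only [angularFourier_eq_fourier]
    field_simp
  -- Compact support makes f̂ integrable, so inversion holds a.e. and the second transform is, up to
  -- 2π and a reflection, the L¹ function f itself.
  have h1 : Integrable (𝓕⁻ (𝓕 f)) := hf.congr (fourierInv_fourier_ae_eq hf hF).symm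
  rw [show angularFourier (angularFourier f) = fun x => 2 * Real.pi * 𝓕⁻ (𝓕 f) (-x) from
    funext (angularFourier_angularFourier f)]
  exact h1.comp_neg.const_mul _

/-- A continuous integrable function with vanishing Fourier transform is zero. -/
theorem eq_zero_of_angularFourier_eq_zero {φ : ℝ → ℂ} (hc : Continuous φ) (hi : Integrable φ)
    (h : ∀ x, angularFourier φ x = 0) : φ = 0 := by
  have h0 : 𝓕 φ = 0 := by
    funext x
    have := h (x * (2 * Real.pi))
    rwa [angularFourier_eq_fourier, mul_div_cancel_right₀ _ (by positivity)] at this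
  have := hc.fourierInv_fourier_eq hi (by rw [h0]; exact integrable_zero _ _ _)
  rw [← this, h0]
  funext x
  simp [Real.fourierInv_eq]

/-- Real nonnegative kernels arising as Fourier transforms of admissible multipliers. -/
structure IsNonnegKernel (F : ℝ → ℝ) : Prop where
  continuous : Continuous F
  nonneg : ∀ x, 0 ≤ F x
  integrable : Integrable F
  tendsto_zero : Tendsto F (cocompact ℝ) (𝓝 0)
  exists_pos : ∃ u, 0 < F u

theorem exists_kernel {φ : ℝ → ℂ} (h : MemWienerAlgebraCompact φ) (h0 : φ ≠ 0)
    (hn : NonnegFourier φ) :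
    ∃ F : ℝ → ℝ, IsNonnegKernel F ∧ ∀ x, angularFourier φ x = (F x : ℂ) := by
  have key : ∀ x, angularFourier φ x = ((angularFourier φ x).re : ℂ) := fun x =>
    Complex.ext (by simp) (by simp [(hn x).2])
  refine ⟨fun x => (angularFourier φ x).re, ⟨?_, fun x => (hn x).1, ?_, ?_, ?_⟩, key⟩
  · exact Complex.continuous_re.comp (continuous_angularFourier h.integrable)
  · exact h.integrable_angularFourier.re
  · simpa using! (Complex.continuous_re.tendsto 0).comp (tendsto_angularFourier_cocompact φ)
  -- A kernel that is nowhere positive would vanish, and injectivity of the transform would force φ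
  -- = 0.
  · by_contra! hcon
    refine h0 (eq_zero_of_angularFourier_eq_zero h.continuous h.integrable fun x => ?_)
    rw [key x, le_antisymm (hcon x) (hn x).1, Complex.ofReal_zero]

/-! ### The Fejér multiplier is admissible. -/

theorem fejerMultiplier_eq_max (t : ℝ) : fejerMultiplier t = ((max (1 - |t|) 0 : ℝ) : ℂ) := by
  unfold fejerMultiplier
  by_cases h : t ∈ Icc (-1 : ℝ) 1
  · rw [indicator_of_mem h, max_eq_left (by linarith [abs_le.2 h])]
  · rw [indicator_of_notMem h, max_eq_right, Complex.ofReal_zero]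
    by_contra! hc
    exact h (abs_le.1 (by linarith))

theorem continuous_fejerMultiplier : Continuous fejerMultiplier := by
  rw [show fejerMultiplier = _ from funext fejerMultiplier_eq_max]
  fun_prop

theorem hasCompactSupport_fejerMultiplier : HasCompactSupport fejerMultiplier :=
  HasCompactSupport.intro (K := Icc (-1 : ℝ) 1) isCompact_Icc fun x hx => by
    rw [fejerMultiplier, indicator_of_notMem hx]

theorem integrable_fejerMultiplier : Integrable fejerMultiplier :=
  continuous_fejerMultiplier.integrable_of_hasCompactSupport hasCompactSupport_fejerMultiplier

theorem fejerMultiplier_neg (t : ℝ) : fejerMultiplier (-t) = fejerMultiplier t := by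
  simp [fejerMultiplier_eq_max]

theorem integral_one_sub_mul_cos {x : ℝ} (hx : x ≠ 0) :
    ∫ t in (0 : ℝ)..1, (1 - t) * Real.cos (x * t) = (1 - Real.cos x) / x ^ 2 := by
  have hd : ∀ t ∈ uIcc (0 : ℝ) 1, HasDerivAt
      (fun t : ℝ => (1 - t) * (Real.sin (x * t) / x) - Real.cos (x * t) / x ^ 2)
      ((1 - t) * Real.cos (x * t)) t := fun t _ => by
    have h1 : HasDerivAt (fun t : ℝ => x * t) x t := by
      simpa using (hasDerivAt_id t).const_mul x
    have h2 := ((hasDerivAt_id t).const_sub 1).mul (h1.sin.div_const x)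
    have h3 := h2.sub (h1.cos.div_const (x ^ 2))
    convert! h3 using 1
    simp only [id]
    field_simp
    ring
  rw [intervalIntegral.integral_eq_sub_of_hasDerivAt hd
    (Continuous.intervalIntegrable (by fun_prop) _ _)]
  simp
  ring

theorem angularFourier_fejerMultiplier (x : ℝ) :
    angularFourier fejerMultiplier x =
      ((2 * ∫ t in (0 : ℝ)..1, (1 - t) * Real.cos (x * t) : ℝ) : ℂ) := by
  have hcont : Continuous fun t : ℝ =>
      Complex.exp (-(Complex.I * (x : ℂ) * (t : ℂ))) * fejerMultiplier t :=
    Continuous.mul (by fun_prop) continuous_fejerMultiplier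
  have h1 : angularFourier fejerMultiplier x = ∫ t in (-1 : ℝ)..1,
      Complex.exp (-(Complex.I * (x : ℂ) * (t : ℂ))) * fejerMultiplier t := by
    rw [intervalIntegral.integral_of_le (by norm_num), ← integral_Icc_eq_integral_Ioc,
      angularFourier, setIntegral_eq_integral_of_forall_compl_eq_zero]
    intro t ht
    rw [fejerMultiplier, indicator_of_notMem ht, mul_zero]
  rw [h1, ← intervalIntegral.integral_add_adjacent_intervals (b := 0)
    (hcont.intervalIntegrable _ _) (hcont.intervalIntegrable _ _)]
  have h2 : (∫ t in (-1 : ℝ)..0,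
      Complex.exp (-(Complex.I * (x : ℂ) * (t : ℂ))) * fejerMultiplier t) =
      ∫ t in (0 : ℝ)..1, Complex.exp (Complex.I * (x : ℂ) * (t : ℂ)) * fejerMultiplier t := by
    have := intervalIntegral.integral_comp_neg (a := 0) (b := 1) (fun t : ℝ =>
      Complex.exp (-(Complex.I * (x : ℂ) * (t : ℂ))) * fejerMultiplier t)
    rw [neg_zero] at this
    rw [← this]
    simp [fejerMultiplier_neg]
  have hcont' : Continuous fun t : ℝ =>
      Complex.exp (Complex.I * (x : ℂ) * (t : ℂ)) * fejerMultiplier t :=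
    Continuous.mul (by fun_prop) continuous_fejerMultiplier
  rw [h2, ← intervalIntegral.integral_add (hcont'.intervalIntegrable _ _)
    (hcont.intervalIntegrable _ _), ← intervalIntegral.integral_const_mul,
    ← intervalIntegral.integral_ofReal]
  refine intervalIntegral.integral_congr fun t ht => ?_
  rw [uIcc_of_le zero_le_one] at ht
  have hv : fejerMultiplier t = ((1 - t : ℝ) : ℂ) := by
    rw [fejerMultiplier_eq_max, abs_of_nonneg ht.1, max_eq_left (by linarith [ht.2])]
  simp only [hv]
  push_cast
  rw [Complex.cos]
  ring_nf

theorem angularFourier_fejerMultiplier_of_ne {x : ℝ} (hx : x ≠ 0) :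
    angularFourier fejerMultiplier x = ((2 * ((1 - Real.cos x) / x ^ 2) : ℝ) : ℂ) := by
  rw [angularFourier_fejerMultiplier, integral_one_sub_mul_cos hx]

theorem angularFourier_fejerMultiplier_zero : angularFourier fejerMultiplier 0 = 1 := by
  rw [angularFourier_fejerMultiplier]
  simp only [zero_mul, Real.cos_zero, mul_one]
  rw [intervalIntegral.integral_sub (by simp) (by simp)]
  simp
  norm_num

theorem integrable_angularFourier_fejerMultiplier :
    Integrable (angularFourier fejerMultiplier) := by
  refine Integrable.mono' (integrable_inv_one_add_sq.const_mul 5)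
    (continuous_angularFourier integrable_fejerMultiplier).aestronglyMeasurable
    (.of_forall fun x => ?_)
  by_cases hx : x = 0
  · subst hx
    rw [angularFourier_fejerMultiplier_zero]
    norm_num
  · have hx2 : 0 < x ^ 2 := by positivity
    have hcos := Real.cos_le_one x
    rw [angularFourier_fejerMultiplier_of_ne hx, Complex.norm_real, Real.norm_eq_abs,
      abs_of_nonneg (mul_nonneg zero_le_two (div_nonneg (by linarith) hx2.le)),
      ← div_eq_mul_inv, mul_div_assoc', div_le_div_iff₀ hx2 (by positivity)]
    -- The constant 5 is 1 + 4: 2(1 - cos x) ≤ x² and 2(1 - cos x)x² ≤ 4x².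
    nlinarith [Real.one_sub_sq_div_two_le_cos (x := x), Real.neg_one_le_cos x]

theorem nonnegFourier_fejerMultiplier : NonnegFourier fejerMultiplier := by
  intro x
  by_cases hx : x = 0
  · subst hx
    simp [angularFourier_fejerMultiplier_zero]
  · rw [angularFourier_fejerMultiplier_of_ne hx]
    refine ⟨?_, Complex.ofReal_im _⟩
    rw [Complex.ofReal_re]
    exact mul_nonneg zero_le_two (div_nonneg (by linarith [Real.cos_le_one x]) (sq_nonneg x))

theorem fejerMultiplier_ne_zero : fejerMultiplier ≠ 0 := fun h => by
  have := congrFun h 0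
  simp [fejerMultiplier_eq_max] at this

/-- The multiplier is even and its transform is integrable, so by inversion it is the transform of
(2π)⁻¹ times its own transform. -/
theorem memWienerAlgebraCompact_fejerMultiplier : MemWienerAlgebraCompact fejerMultiplier := by
  refine ⟨⟨fun x => (2 * Real.pi : ℂ)⁻¹ * angularFourier fejerMultiplier x,
    integrable_angularFourier_fejerMultiplier.const_mul _, ?_⟩, hasCompactSupport_fejerMultiplier⟩
  have hpi : (2 * Real.pi) ≠ 0 := by positivity
  have hpi' : (2 * Real.pi : ℂ) ≠ 0 := by exact_mod_cast hpi
  have hF : Integrable (𝓕 fejerMultiplier) := by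
    refine (integrable_angularFourier_fejerMultiplier.comp_mul_right' hpi).congr
      (.of_forall fun t => ?_)
    simp only [angularFourier_eq_fourier, mul_div_cancel_right₀ _ hpi]
  have hinv := continuous_fejerMultiplier.fourierInv_fourier_eq integrable_fejerMultiplier hF
  funext t
  have h := angularFourier_angularFourier fejerMultiplier t
  rw [hinv, fejerMultiplier_neg] at h
  have h2 : angularFourier (fun x => (2 * Real.pi : ℂ)⁻¹ * angularFourier fejerMultiplier x) t =
      (2 * Real.pi : ℂ)⁻¹ * angularFourier (angularFourier fejerMultiplier) t := by
    rw [angularFourier, angularFourier, ← integral_const_mul]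
    refine integral_congr_ae (.of_forall fun x => ?_)
    ring
  rw [h2, h, inv_mul_cancel_left₀ hpi']

end

/-! ### Laplace integrals, their kernel form, and the one-sided bound. -/

theorem norm_exp_neg_mul_mul (S : ℝ → ℝ) (s : ℂ) (x : ℝ) :
    ‖Complex.exp (-(s * (x : ℂ))) * (S x : ℂ)‖ = ‖Real.exp (-(s.re * x)) * S x‖ := by
  rw [norm_mul, Complex.norm_exp, norm_mul, Complex.norm_real, Real.norm_eq_abs (Real.exp _),
    abs_of_pos (Real.exp_pos _)]
  simp

theorem LocallyIntegrableOn.aestronglyMeasurable_Ioi {S : ℝ → ℝ}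
    (hS : LocallyIntegrableOn S (Ici 0)) :
    AEStronglyMeasurable S (volume.restrict (Ioi 0)) :=
  hS.aestronglyMeasurable.mono_measure (Measure.restrict_mono Ioi_subset_Ici_self le_rfl)

/-- Absolute convergence of the Laplace integral only depends on the real part. -/
theorem integrableOn_laplace_iff {S : ℝ → ℝ} (hS : LocallyIntegrableOn S (Ici 0)) (s : ℂ) :
    IntegrableOn (fun x : ℝ => Complex.exp (-(s * (x : ℂ))) * (S x : ℂ)) (Ioi 0) ↔
      IntegrableOn (fun x : ℝ => Real.exp (-(s.re * x)) * S x) (Ioi 0) := by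
  have hm := LocallyIntegrableOn.aestronglyMeasurable_Ioi hS
  have h1 : AEStronglyMeasurable (fun x : ℝ => Complex.exp (-(s * (x : ℂ))) * (S x : ℂ))
      (volume.restrict (Ioi 0)) :=
    (Continuous.aestronglyMeasurable (by fun_prop)).mul
      (Complex.continuous_ofReal.comp_aestronglyMeasurable hm)
  have h2 : AEStronglyMeasurable (fun x : ℝ => Real.exp (-(s.re * x)) * S x)
      (volume.restrict (Ioi 0)) :=
    (Continuous.aestronglyMeasurable (by fun_prop)).mul hm
  rw [IntegrableOn, IntegrableOn, ← integrable_norm_iff h1, ← integrable_norm_iff h2]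
  simp only [norm_exp_neg_mul_mul]

theorem tendsto_laplacePartial {S : ℝ → ℝ} {s : ℂ}
    (h : IntegrableOn (fun x : ℝ => Complex.exp (-(s * (x : ℂ))) * (S x : ℂ)) (Ioi 0)) :
    Tendsto (laplacePartial S s) atTop
      (𝓝 (∫ x in Ioi (0 : ℝ), Complex.exp (-(s * (x : ℂ))) * (S x : ℂ))) :=
  intervalIntegral_tendsto_integral_Ioi 0 h tendsto_id

theorem laplaceTransform_eq_integral {S : ℝ → ℝ} {s : ℂ}
    (h : IntegrableOn (fun x : ℝ => Complex.exp (-(s * (x : ℂ))) * (S x : ℂ)) (Ioi 0)) :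
    laplaceTransform S s = ∫ x in Ioi (0 : ℝ), Complex.exp (-(s * (x : ℂ))) * (S x : ℂ) :=
  (tendsto_laplacePartial h).limUnder_eq

theorem integrableOn_exp_neg_mul {η : ℝ} (hη : 0 < η) (X : ℝ) :
    IntegrableOn (fun x : ℝ => Real.exp (-(η * x))) (Ioi X) := by
  simpa using integrableOn_exp_mul_Ioi (neg_neg_of_pos hη) X

theorem integrableOn_laplace_sub_exp {S : ℝ → ℝ} (a : ℝ)
    {σ : ℝ} (hσ : 1 < σ)
    (h : IntegrableOn (fun x : ℝ => Real.exp (-(σ * x)) * S x) (Ioi 0)) :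
    IntegrableOn (fun x : ℝ => Real.exp (-((σ - 1) * x)) * (S x * Real.exp (-x) - a)) (Ioi 0) := by
  refine (h.sub ((integrableOn_exp_neg_mul (sub_pos.2 hσ) 0).mul_const a)).congr
    (.of_forall fun x => ?_)
  have : Real.exp (-(σ * x)) = Real.exp (-((σ - 1) * x)) * Real.exp (-x) := by
    rw [← Real.exp_add]; ring_nf
  simp only [Pi.sub_apply, this]
  ring

theorem laplaceMinusPole_eq_integral {S : ℝ → ℝ} (hS : LocallyIntegrableOn S (Ici 0)) (a : ℝ)
    {s : ℂ} (hs : 1 < s.re)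
    (h : IntegrableOn (fun x : ℝ => Real.exp (-(s.re * x)) * S x) (Ioi 0)) :
    laplaceMinusPole S a s = ∫ x in Ioi (0 : ℝ),
      Complex.exp (-((s - 1) * (x : ℂ))) * ((S x * Real.exp (-x) - a : ℝ) : ℂ) := by
  have hc := (integrableOn_laplace_iff hS s).2 h
  have hre : (-(s - 1)).re < 0 := by simpa using hs
  have h1 := integral_exp_mul_complex_Ioi hre 0
  have h2 := integrableOn_exp_mul_complex_Ioi hre 0
  have h3 : (a : ℂ) / (s - 1) = ∫ x in Ioi (0 : ℝ), Complex.exp (-(s - 1) * (x : ℂ)) * a := by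
    rw [integral_mul_const, h1]
    rw [Complex.ofReal_zero, mul_zero, Complex.exp_zero, neg_div_neg_eq, one_div,
      div_eq_mul_inv, mul_comm]
  rw [laplaceMinusPole, laplaceTransform_eq_integral hc, h3, ← integral_sub hc (h2.mul_const _)]
  refine integral_congr_ae (.of_forall fun x => ?_)
  have : Complex.exp (-(s * (x : ℂ))) = Complex.exp (-(s - 1) * (x : ℂ)) * Complex.exp (-x) := by
    rw [← Complex.exp_add]; ring_nf
  simp only [this, neg_mul]
  push_cast
  ring

/-- The dilated and translated kernel `λ F(λ(x - h))`. -/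
noncomputable def scaledKernel (F : ℝ → ℝ) (lam h x : ℝ) : ℝ := lam * F (lam * (x - h))

theorem integral_exp_mul_comp_div {φ : ℝ → ℂ} {F : ℝ → ℝ}
    (hF : ∀ x, angularFourier φ x = (F x : ℂ)) {lam : ℝ} (hl : 0 < lam) (h x : ℝ) :
    ∫ t : ℝ, Complex.exp (Complex.I * (t : ℂ) * ((h - x : ℝ) : ℂ)) * φ (t / lam) =
      (scaledKernel F lam h x : ℂ) := by
  have key := Measure.integral_comp_div (fun u : ℝ =>
    Complex.exp (-(Complex.I * ((lam * (x - h) : ℝ) : ℂ) * (u : ℂ))) * φ u) lam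
  rw [abs_of_pos hl, Complex.real_smul] at key
  rw [scaledKernel, Complex.ofReal_mul, ← hF, angularFourier, ← key]
  refine integral_congr_ae (.of_forall fun t => ?_)
  have : (lam : ℂ) ≠ 0 := by exact_mod_cast hl.ne'
  simp only
  congr 2
  push_cast
  field_simp
  ring

/-- The smoothed Laplace transform on vertical lines as a real convolution integral. -/
theorem integral_laplaceMinusPole {S : ℝ → ℝ} (hS : LocallyIntegrableOn S (Ici 0)) (a : ℝ)
    {φ : ℝ → ℂ} (hφ : Integrable φ) {F : ℝ → ℝ} (hF : ∀ x, angularFourier φ x = (F x : ℂ))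
    {lam : ℝ} (hl : 0 < lam) {σ : ℝ} (hσ : 1 < σ)
    (H : IntegrableOn (fun x : ℝ => Real.exp (-(σ * x)) * S x) (Ioi 0)) (h : ℝ) :
    ∫ t : ℝ, laplaceMinusPole S a ((σ : ℂ) + Complex.I * (t : ℂ)) *
        Complex.exp (Complex.I * (h : ℂ) * (t : ℂ)) * φ (t / lam) =
      ((∫ x in Ioi (0 : ℝ), Real.exp (-((σ - 1) * x)) * (S x * Real.exp (-x) - a) *
        scaledKernel F lam h x : ℝ) : ℂ) := by
  set q : ℝ → ℝ := fun x => Real.exp (-((σ - 1) * x)) * (S x * Real.exp (-x) - a) with hq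
  have hqi : Integrable q (volume.restrict (Ioi 0)) := integrableOn_laplace_sub_exp a hσ H
  have hφl : Integrable fun t : ℝ => φ (t / lam) := hφ.comp_div hl.ne'
  let f : ℝ → ℝ → ℂ := fun t x =>
    Complex.exp (Complex.I * (t : ℂ) * ((h - x : ℝ) : ℂ)) * (φ (t / lam) * (q x : ℂ))
  -- Fubini applies: the integrand is a unimodular factor times a product of integrable functions of
  -- t and of x.
  have hprod : Integrable (Function.uncurry f) (volume.prod (volume.restrict (Ioi 0))) := by
    refine (hφl.mul_prod hqi.ofReal).bdd_mul (c := 1)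
      (Continuous.aestronglyMeasurable (by fun_prop)) (.of_forall fun p => ?_)
    rw [Complex.norm_exp]
    simp
  have hL : ∀ t : ℝ, laplaceMinusPole S a ((σ : ℂ) + Complex.I * (t : ℂ)) *
        Complex.exp (Complex.I * (h : ℂ) * (t : ℂ)) * φ (t / lam) = ∫ x in Ioi (0 : ℝ), f t x := by
    intro t
    rw [laplaceMinusPole_eq_integral hS a (by simpa using hσ) (by simpa using H), mul_assoc,
      ← integral_mul_const]
    refine integral_congr_ae (.of_forall fun x => ?_)
    have h1 : Complex.exp (-(((σ : ℂ) + Complex.I * (t : ℂ) - 1) * (x : ℂ))) *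
        Complex.exp (Complex.I * (h : ℂ) * (t : ℂ)) =
        Complex.exp (Complex.I * (t : ℂ) * ((h - x : ℝ) : ℂ)) *
          (Real.exp (-((σ - 1) * x)) : ℂ) := by
      rw [← Complex.exp_add, Complex.ofReal_exp, ← Complex.exp_add]
      push_cast
      ring_nf
    simp only [f, hq]
    rw [Complex.ofReal_mul]
    linear_combination (((S x * Real.exp (-x) - a : ℝ) : ℂ) * φ (t / lam)) * h1
  simp_rw [hL]
  rw [integral_integral_swap hprod, ← integral_complex_ofReal]
  refine integral_congr_ae (.of_forall fun x => ?_)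
  simp only [f]
  rw [Complex.ofReal_mul _ (scaledKernel F lam h x), ← integral_exp_mul_comp_div hF hl,
    ← integral_const_mul]
  refine integral_congr_ae (.of_forall fun t => ?_)
  simp only
  ring

/-- A log-linearly slowly decreasing function is bounded below by a multiple of `e^x`. -/
theorem LogLinearlySlowlyDecreasing.exists_lower_bound {S : ℝ → ℝ}
    (h : LogLinearlySlowlyDecreasing S) :
    ∃ X : ℝ, 0 ≤ X ∧ ∃ C : ℝ, 0 ≤ C ∧ ∀ x, X ≤ x → -C ≤ S x * Real.exp (-x) := by
  obtain ⟨δ, hδ, x₀, hx₀⟩ := h 1 one_pos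
  have step : ∀ x, x₀ ≤ x → ∀ u, 0 ≤ u → u ≤ δ → S x - Real.exp x ≤ S (x + u) := by
    intro x hx u hu hu'
    have := hx₀ x hx u hu hu'
    rw [le_div_iff₀ (Real.exp_pos x)] at this
    linarith
  set X := max x₀ 0
  have hX0 : 0 ≤ X := le_max_right _ _
  have he : 0 < Real.exp δ - 1 := by linarith [Real.add_one_le_exp δ]
  -- D solves D e^δ = D + 1, so passing from D e^y to D e^{y+δ} pays exactly for the loss e^y of one
  -- step of length δ.
  set D := 1 / (Real.exp δ - 1)
  have hD : 0 < D := by positivity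
  have hDe : D * Real.exp δ = D + 1 := by
    have : D * (Real.exp δ - 1) = 1 := one_div_mul_cancel he.ne'
    linarith
  have hind : ∀ n : ℕ, -|S X| - D * Real.exp (X + n * δ) ≤ S (X + n * δ) := by
    intro n
    induction n with
    | zero =>
      have : 0 < D * Real.exp X := by positivity
      simp only [Nat.cast_zero, zero_mul, add_zero]
      linarith [neg_abs_le (S X)]
    | succ n ih =>
      have hle : x₀ ≤ X + n * δ := (le_max_left x₀ 0).trans (by
        have : 0 ≤ n * δ := by positivity
        linarith)
      have h1 := step _ hle δ hδ.le le_rfl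
      have h2 : X + ((n + 1 : ℕ) : ℝ) * δ = X + n * δ + δ := by push_cast; ring
      rw [h2, Real.exp_add (X + n * δ)]
      have h3 : D * (Real.exp (X + n * δ) * Real.exp δ) = (D + 1) * Real.exp (X + n * δ) := by
        rw [← hDe]; ring
      rw [h3]
      linarith
  -- The extra 1 pays for the last, incomplete step; |S X| is absorbed because e^x ≥ 1 for x ≥ X ≥
  -- 0.
  refine ⟨X, hX0, |S X| + D + 1, by positivity, fun x hx => ?_⟩
  set n := ⌊(x - X) / δ⌋₊
  have hn1 : n * δ ≤ x - X :=
    (le_div_iff₀ hδ).1 (Nat.floor_le (div_nonneg (sub_nonneg.2 hx) hδ.le))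
  have hn2 : x - X < (n + 1) * δ := (div_lt_iff₀ hδ).1 (Nat.lt_floor_add_one _)
  have hnn : 0 ≤ n * δ := by positivity
  have h1 := step (X + n * δ) ((le_max_left x₀ 0).trans (by linarith)) (x - (X + n * δ))
    (by linarith) (by linarith)
  rw [add_sub_cancel] at h1
  have h2 := hind n
  have hmono : Real.exp (X + n * δ) ≤ Real.exp x := Real.exp_le_exp.2 (by linarith)
  have hx1 : 1 ≤ Real.exp x := Real.one_le_exp (hX0.trans hx)
  have h3 : (D + 1) * Real.exp (X + n * δ) ≤ (D + 1) * Real.exp x := by gcongr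
  have h4 : |S X| * 1 ≤ |S X| * Real.exp x := by gcongr
  rw [Real.exp_neg, ← div_eq_mul_inv, le_div_iff₀ (Real.exp_pos x)]
  linarith

/-- With a one-sided bound, convergence of the Laplace integral implies absolute convergence. -/
theorem integrableOn_laplace_of_converges {S : ℝ → ℝ} (hS : LocallyIntegrableOn S (Ici 0))
    {X C : ℝ} (hX : 0 ≤ X) (hb : ∀ x, X ≤ x → -C ≤ S x * Real.exp (-x)) {σ : ℝ} (hσ : 1 < σ)
    (hconv : LaplaceConvergesAt S σ) :
    IntegrableOn (fun x : ℝ => Real.exp (-(σ * x)) * S x) (Ioi 0) := by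
  obtain ⟨L, hL⟩ := hconv
  set g : ℝ → ℝ := fun x => Real.exp (-(σ * x)) * S x
  have hgl : ∀ b, 0 ≤ b → IntegrableOn g (Icc 0 b) := fun b _ =>
    (hS.integrableOn_compact_subset Icc_subset_Ici_self isCompact_Icc).continuousOn_mul
      (Continuous.continuousOn (by fun_prop)) isCompact_Icc
  have hgi : ∀ u v, 0 ≤ u → u ≤ v → IntervalIntegrable g volume u v := fun u v hu huv =>
    (intervalIntegrable_iff_integrableOn_Icc_of_le huv).2
      ((hgl v (hu.trans huv)).mono_set (Icc_subset_Icc_left hu))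
  have hpart : ∀ b, 0 ≤ b → laplacePartial S σ b = ((∫ x in (0 : ℝ)..b, g x : ℝ) : ℂ) := by
    intro b hb
    rw [laplacePartial, ← intervalIntegral.integral_ofReal]
    refine intervalIntegral.integral_congr fun x _ => ?_
    simp [g]
  have hlim : Tendsto (fun b : ℝ => ∫ x in (0 : ℝ)..b, g x) atTop (𝓝 L.re) := by
    refine ((Complex.continuous_re.tendsto L).comp hL).congr' ?_
    filter_upwards [eventually_ge_atTop 0] with b hb
    simp [hpart b hb]
  -- Adding `e` makes the integrand nonnegative beyond X, where convergence of the partial integrals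
  -- is integrability.
  set e : ℝ → ℝ := fun x => Real.exp (-((σ - 1) * x)) * C
  have hei : IntegrableOn e (Ioi X) := (integrableOn_exp_neg_mul (sub_pos.2 hσ) X).mul_const C
  have helim := intervalIntegral_tendsto_integral_Ioi X hei tendsto_id
  have hei' : ∀ b, IntervalIntegrable e volume X b := fun b =>
    Continuous.intervalIntegrable (by fun_prop) _ _
  have hpos : ∀ x, X ≤ x → 0 ≤ g x + e x := by
    intro x hx
    have : g x + e x = Real.exp (-((σ - 1) * x)) * (S x * Real.exp (-x) + C) := by
      have : Real.exp (-(σ * x)) = Real.exp (-((σ - 1) * x)) * Real.exp (-x) := by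
        rw [← Real.exp_add]; ring_nf
      simp only [g, e, this]
      ring
    rw [this]
    exact mul_nonneg (Real.exp_pos _).le (by linarith [hb x hx])
  have hsum : IntegrableOn (fun x => g x + e x) (Ioi X) := by
    refine integrableOn_Ioi_of_intervalIntegral_norm_tendsto
      (L.re - (∫ x in (0 : ℝ)..X, g x) + ∫ x in Ioi X, e x) X (b := id) (l := atTop)
      (fun b => ?_) tendsto_id ?_
    · by_cases hXb : X ≤ b
      · exact ((hgi X b hX hXb).add (hei' b)).1
      · rw [id, Ioc_eq_empty (fun hlt => hXb hlt.le)]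
        exact integrableOn_empty
    · refine ((hlim.sub_const (∫ x in (0 : ℝ)..X, g x)).add helim).congr' ?_
      filter_upwards [eventually_ge_atTop X] with b hb
      rw [intervalIntegral.integral_interval_sub_left (hgi 0 b le_rfl (hX.trans hb))
        (hgi 0 X le_rfl hX), id, ← intervalIntegral.integral_add (hgi X b hX hb) (hei' b)]
      refine intervalIntegral.integral_congr fun x hx => ?_
      rw [uIcc_of_le hb] at hx
      exact (Real.norm_of_nonneg (hpos x hx.1)).symm
  have hg2 : IntegrableOn g (Ioi X) :=
    (hsum.sub hei).congr (.of_forall fun x => by simp)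
  rw [← Ioc_union_Ioi_eq_Ioi hX]
  exact ((hgl X hX).mono_set Ioc_subset_Icc_self).union hg2

/-! ### Abel means and convolution with the scaled kernel. -/

/-- Abelian summation of an integrable function. -/
theorem tendsto_integral_exp_mul {s : Set ℝ} (hs : MeasurableSet s) (hs0 : s ⊆ Ioi 0) {g : ℝ → ℝ}
    (hi : IntegrableOn g s) :
    Tendsto (fun σ : ℝ => ∫ x in s, Real.exp (-((σ - 1) * x)) * g x)
      (𝓝[>] 1) (𝓝 (∫ x in s, g x)) := by
  refine tendsto_integral_filter_of_dominated_convergence (fun x => ‖g x‖)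
    (.of_forall fun σ => ?_) ?_ hi.norm (.of_forall fun x => ?_)
  · exact (Continuous.aestronglyMeasurable (by fun_prop)).mul hi.aestronglyMeasurable
  · filter_upwards [self_mem_nhdsWithin] with σ hσ
    filter_upwards [ae_restrict_mem hs] with x hx
    rw [norm_mul, Real.norm_of_nonneg (Real.exp_pos _).le]
    refine mul_le_of_le_one_left (norm_nonneg _) (Real.exp_le_one_iff.2 ?_)
    have := mul_pos (sub_pos.2 (mem_Ioi.1 hσ)) (mem_Ioi.1 (hs0 hx))
    linarith
  · have : Continuous fun σ : ℝ => Real.exp (-((σ - 1) * x)) * g x := by fun_prop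
    simpa using (this.tendsto 1).mono_left nhdsWithin_le_nhds

theorem IntegrableOn.exp_mul {s : Set ℝ} (hs : MeasurableSet s) (hs0 : s ⊆ Ioi 0) {g : ℝ → ℝ}
    (hi : IntegrableOn g s) {σ : ℝ} (hσ : 1 < σ) :
    IntegrableOn (fun x => Real.exp (-((σ - 1) * x)) * g x) s := by
  refine Integrable.bdd_mul hi (c := 1) (Continuous.aestronglyMeasurable (by fun_prop)) ?_
  filter_upwards [ae_restrict_mem hs] with x hx
  rw [Real.norm_of_nonneg (Real.exp_pos _).le]
  refine Real.exp_le_one_iff.2 ?_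
  have := mul_pos (sub_pos.2 hσ) (mem_Ioi.1 (hs0 hx))
  linarith

namespace IsNonnegKernel

variable {F : ℝ → ℝ}

theorem exists_bound (hF : IsNonnegKernel F) : ∃ M, ∀ x, F x ≤ M := by
  let f : ZeroAtInftyContinuousMap ℝ ℝ := ⟨⟨F, hF.continuous⟩, hF.tendsto_zero⟩
  obtain ⟨M, hM⟩ := f.isBounded_range.exists_norm_le
  exact ⟨M, fun x => (le_abs_self _).trans (hM _ ⟨x, rfl⟩)⟩

theorem integral_pos (hF : IsNonnegKernel F) : 0 < ∫ x, F x := by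
  obtain ⟨u, hu⟩ := hF.exists_pos
  exact integral_pos_of_integrable_nonneg_nonzero hF.continuous hF.integrable
    (fun x => hF.nonneg x) hu.ne'

theorem continuous_scaledKernel (hF : IsNonnegKernel F) (lam h : ℝ) :
    Continuous (scaledKernel F lam h) :=
  continuous_const.mul (hF.continuous.comp (by fun_prop))

theorem scaledKernel_nonneg (hF : IsNonnegKernel F) {lam : ℝ} (hl : 0 < lam) (h x : ℝ) :
    0 ≤ scaledKernel F lam h x := mul_nonneg hl.le (hF.nonneg _)

end IsNonnegKernel

theorem integrable_scaledKernel {F : ℝ → ℝ} (hF : Integrable F) {lam : ℝ} (hl : 0 < lam)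
    (h : ℝ) : Integrable (scaledKernel F lam h) :=
  ((hF.comp_mul_left' hl.ne').comp_sub_right h).const_mul lam

theorem integral_scaledKernel (F : ℝ → ℝ) {lam : ℝ} (hl : 0 < lam) (h : ℝ) :
    ∫ x, scaledKernel F lam h x = ∫ x, F x := by
  simp only [scaledKernel]
  rw [integral_const_mul, integral_sub_right_eq_self (fun x => F (lam * x)) h,
    Measure.integral_comp_mul_left, abs_of_pos (inv_pos.2 hl), smul_eq_mul,
    mul_inv_cancel_left₀ hl.ne']

namespace IsNonnegKernel

variable {F : ℝ → ℝ}

theorem integrable_mul_scaledKernel (hF : IsNonnegKernel F) {μ : Measure ℝ} {r : ℝ → ℝ}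
    (hr : Integrable r μ) {lam : ℝ} (hl : 0 < lam) (h : ℝ) :
    Integrable (fun x => r x * scaledKernel F lam h x) μ := by
  obtain ⟨M, hM⟩ := hF.exists_bound
  refine hr.mul_bdd (c := lam * M) (hF.continuous_scaledKernel lam h).aestronglyMeasurable
    (.of_forall fun x => ?_)
  rw [Real.norm_of_nonneg (hF.scaledKernel_nonneg hl h x)]
  exact mul_le_mul_of_nonneg_left (hM _) hl.le

/-- Moving the kernel to infinity kills every integrable function. -/
theorem tendsto_integral_mul_scaledKernel (hF : IsNonnegKernel F) {μ : Measure ℝ} {r : ℝ → ℝ}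
    (hr : Integrable r μ) {lam : ℝ} (hl : 0 < lam) :
    Tendsto (fun h => ∫ x, r x * scaledKernel F lam h x ∂μ) atTop (𝓝 0) := by
  obtain ⟨M, hM⟩ := hF.exists_bound
  rw [← integral_zero ℝ ℝ (μ := μ)]
  refine tendsto_integral_filter_of_dominated_convergence (fun x => ‖r x‖ * (lam * M))
    (.of_forall fun h => (hF.integrable_mul_scaledKernel hr hl h).aestronglyMeasurable)
    (.of_forall fun h => .of_forall fun x => ?_) (hr.norm.mul_const _) (.of_forall fun x => ?_)
  · rw [norm_mul, Real.norm_of_nonneg (hF.scaledKernel_nonneg hl h x)]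
    exact mul_le_mul_of_nonneg_left (mul_le_mul_of_nonneg_left (hM _) hl.le) (norm_nonneg _)
  · have h1 : Tendsto (fun h : ℝ => lam * (x - h)) atTop (cocompact ℝ) := by
      refine Tendsto.mono_right ?_ atBot_le_cocompact
      refine Tendsto.const_mul_atBot hl ?_
      exact (tendsto_atBot_add_const_left atTop x tendsto_neg_atTop_atBot).congr fun h =>
        (sub_eq_add_neg x h).symm
    simpa [scaledKernel] using ((hF.tendsto_zero.comp h1).const_mul lam).const_mul (r x)

theorem integrableOn_mul_scaledKernel_of_bounded (hF : IsNonnegKernel F) {r : ℝ → ℝ} {X B : ℝ}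
    (hm : AEStronglyMeasurable r (volume.restrict (Ioi X)))
    (hb : ∀ x, X ≤ x → |r x| ≤ B) {lam : ℝ} (hl : 0 < lam) (h : ℝ) :
    IntegrableOn (fun x => r x * scaledKernel F lam h x) (Ioi X) := by
  refine (integrable_scaledKernel hF.integrable hl h).integrableOn.bdd_mul (c := B) hm ?_
  filter_upwards [ae_restrict_mem measurableSet_Ioi] with x hx
  exact hb x (mem_Ioi.1 hx).le

/-- The bound is independent of h and λ, so the cut-off X can be fixed before h → ∞. -/
theorem norm_setIntegral_mul_scaledKernel_le (hF : IsNonnegKernel F) {r : ℝ → ℝ} {X B : ℝ}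
    (hB : 0 ≤ B) (hb : ∀ x, X ≤ x → |r x| ≤ B) {lam : ℝ} (hl : 0 < lam) (h : ℝ) :
    ‖∫ x in Ioi X, r x * scaledKernel F lam h x‖ ≤ B * ∫ x, F x := by
  have hi := integrable_scaledKernel hF.integrable hl h
  calc ‖∫ x in Ioi X, r x * scaledKernel F lam h x‖
      ≤ ∫ x in Ioi X, B * scaledKernel F lam h x := by
        refine norm_integral_le_of_norm_le (hi.const_mul B).integrableOn ?_
        filter_upwards [ae_restrict_mem measurableSet_Ioi] with x hx
        rw [norm_mul, Real.norm_of_nonneg (hF.scaledKernel_nonneg hl h x)]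
        exact mul_le_mul_of_nonneg_right (hb x (mem_Ioi.1 hx).le) (hF.scaledKernel_nonneg hl h x)
    _ ≤ ∫ x, B * scaledKernel F lam h x :=
        setIntegral_le_integral (hi.const_mul B) (.of_forall fun x =>
          mul_nonneg hB (hF.scaledKernel_nonneg hl h x))
    _ = B * ∫ x, F x := by rw [integral_const_mul, integral_scaledKernel F hl h]

/-- The convolution of the kernel with a locally integrable null function tends to zero. -/
theorem tendsto_integral_of_tendsto_zero (hF : IsNonnegKernel F) {r : ℝ → ℝ}
    (hr : LocallyIntegrableOn r (Ici 0)) (h0 : Tendsto r atTop (𝓝 0)) {lam : ℝ} (hl : 0 < lam) :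
    (∀ h, IntegrableOn (fun x => r x * scaledKernel F lam h x) (Ioi 0)) ∧
      Tendsto (fun h => ∫ x in Ioi (0 : ℝ), r x * scaledKernel F lam h x) atTop (𝓝 0) := by
  have hX : ∀ ε > 0, ∃ X : ℝ, 0 ≤ X ∧ ∀ x, X ≤ x → |r x| ≤ ε := by
    intro ε hε
    obtain ⟨X, hX⟩ := Metric.tendsto_atTop.1 h0 ε hε
    refine ⟨max X 0, le_max_right _ _, fun x hx => ?_⟩
    simpa using (hX x ((le_max_left _ _).trans hx)).le
  have hloc : ∀ X, IntegrableOn r (Ioc 0 X) := fun X =>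
    (hr.integrableOn_compact_subset Icc_subset_Ici_self isCompact_Icc).mono_set Ioc_subset_Icc_self
  have hm := LocallyIntegrableOn.aestronglyMeasurable_Ioi hr
  have htail : ∀ X ε, 0 ≤ X → (∀ x, X ≤ x → |r x| ≤ ε) → ∀ h,
      IntegrableOn (fun x => r x * scaledKernel F lam h x) (Ioi X) := fun X ε h0X hXε h =>
    hF.integrableOn_mul_scaledKernel_of_bounded
      (hm.mono_measure (Measure.restrict_mono (Ioi_subset_Ioi h0X) le_rfl)) hXε hl h
  -- On (0, X] the function r is integrable and the kernel bounded; beyond X the roles are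
  -- exchanged.
  refine ⟨fun h => ?_, ?_⟩
  · obtain ⟨X, h0X, hX1⟩ := hX 1 one_pos
    rw [← Ioc_union_Ioi_eq_Ioi h0X]
    exact IntegrableOn.union (hF.integrable_mul_scaledKernel (hloc X) hl h)
      (htail X 1 h0X hX1 h)
  · rw [Metric.tendsto_atTop']
    intro ε hε
    have hA := hF.integral_pos
    obtain ⟨X, h0X, hXe⟩ := hX (ε / 2 / ∫ x, F x) (by positivity)
    obtain ⟨N, hN⟩ := Metric.tendsto_atTop'.1
      (hF.tendsto_integral_mul_scaledKernel (hloc X) hl) (ε / 2) (half_pos hε)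
    refine ⟨N, fun h hh => ?_⟩
    have h1 := hN h hh
    have h2 := hF.norm_setIntegral_mul_scaledKernel_le (by positivity) hXe hl h
    rw [div_mul_cancel₀ _ hA.ne'] at h2
    rw [dist_zero_right] at h1 ⊢
    rw [← Ioc_union_Ioi_eq_Ioi h0X, setIntegral_union (Ioc_disjoint_Ioi le_rfl)
      measurableSet_Ioi (hF.integrable_mul_scaledKernel (hloc X) hl h) (htail X _ h0X hXe h)]
    exact (norm_add_le _ _).trans_lt (by linarith)

end IsNonnegKernel

/-! ### Consequences of S(x) ~ a e^x. -/

theorem locallyIntegrableOn_normalized {S : ℝ → ℝ} (hS : LocallyIntegrableOn S (Ici 0)) (a : ℝ) :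
    LocallyIntegrableOn (fun x => S x * Real.exp (-x) - a) (Ici 0) :=
  (hS.mul_continuousOn (Continuous.continuousOn (by fun_prop))
    isClosed_Ici.isLocallyClosed).sub
    ((locallyIntegrable_const a).locallyIntegrableOn _)

theorem tendsto_normalized_iff {S : ℝ → ℝ} {a : ℝ} :
    Tendsto (fun x : ℝ => S x / Real.exp x) atTop (𝓝 a) ↔
      Tendsto (fun x => S x * Real.exp (-x) - a) atTop (𝓝 0) := by
  rw [← tendsto_sub_nhds_zero_iff]
  simp [Real.exp_neg, div_eq_mul_inv]

theorem logLinearlySlowlyDecreasing_of_tendsto {S : ℝ → ℝ} {a : ℝ}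
    (h : Tendsto (fun x : ℝ => S x / Real.exp x) atTop (𝓝 a)) :
    LogLinearlySlowlyDecreasing S := by
  intro ε hε
  obtain ⟨X, hX⟩ := Metric.tendsto_atTop.1 h (ε / 8) (by positivity)
  have ha : 0 < |a| + 1 := by positivity
  -- The three terms of `h3` cost at most 3ε/8 (as e^u ≤ 3 for u ≤ 1), ε/2 (as e^u - 1 ≤ 2u) and
  -- ε/8.
  refine ⟨min 1 (ε / (4 * (|a| + 1))), by positivity, X, fun x hx u hu hu' => ?_⟩
  have hu1 : u ≤ 1 := hu'.trans (min_le_left _ _)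
  have hu2 : u * (4 * (|a| + 1)) ≤ ε :=
    (le_div_iff₀ (by positivity)).1 (hu'.trans (min_le_right _ _))
  have he := Real.abs_exp_sub_one_le (x := u) (by rwa [abs_of_nonneg hu])
  have he0 : 0 ≤ Real.exp u - 1 := by linarith [Real.add_one_le_exp u]
  rw [abs_of_nonneg he0, abs_of_nonneg hu] at he
  have h1 := abs_lt.1 (by simpa [Real.dist_eq] using hX x hx)
  have h2 := abs_lt.1 (by simpa [Real.dist_eq] using hX (x + u) (by linarith))
  have h3 : (S (x + u) - S x) / Real.exp x =
      (S (x + u) / Real.exp (x + u) - a) * Real.exp u + a * (Real.exp u - 1) -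
        (S x / Real.exp x - a) := by
    rw [Real.exp_add]
    field_simp
    ring
  rw [h3]
  have h4 : -(ε / 8) * 3 ≤ (S (x + u) / Real.exp (x + u) - a) * Real.exp u :=
    calc -(ε / 8) * 3 ≤ -(ε / 8) * Real.exp u :=
          mul_le_mul_of_nonpos_left (by linarith) (by linarith)
      _ ≤ _ := mul_le_mul_of_nonneg_right h2.1.le (Real.exp_pos u).le
  have h5 : -(ε / 2) ≤ a * (Real.exp u - 1) := by
    have h6 : |a| * (Real.exp u - 1) ≤ (|a| + 1) * (2 * u) := by
      gcongr
      linarith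
    have h7 : -|a| * (Real.exp u - 1) ≤ a * (Real.exp u - 1) :=
      mul_le_mul_of_nonneg_right (neg_abs_le a) he0
    linarith
  linarith

theorem integrableOn_laplace_of_tendsto {S : ℝ → ℝ} (hS : LocallyIntegrableOn S (Ici 0)) {a : ℝ}
    (h : Tendsto (fun x : ℝ => S x / Real.exp x) atTop (𝓝 a)) {σ : ℝ} (hσ : 1 < σ) :
    IntegrableOn (fun x : ℝ => Real.exp (-(σ * x)) * S x) (Ioi 0) := by
  obtain ⟨X, hX⟩ := Metric.tendsto_atTop.1 h 1 one_pos
  have hm := LocallyIntegrableOn.aestronglyMeasurable_Ioi hS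
  set Y := max X 0
  have hY : 0 ≤ Y := le_max_right _ _
  rw [← Ioc_union_Ioi_eq_Ioi hY]
  refine IntegrableOn.union ?_ ?_
  · exact IntegrableOn.mono_set ((hS.integrableOn_compact_subset Icc_subset_Ici_self
      isCompact_Icc).continuousOn_mul (Continuous.continuousOn (by fun_prop)) isCompact_Icc)
      Ioc_subset_Icc_self
  · refine Integrable.mono' ((integrableOn_exp_neg_mul (sub_pos.2 hσ) Y).mul_const (|a| + 1))
      ((Continuous.aestronglyMeasurable (by fun_prop)).mul
        (hm.mono_measure (Measure.restrict_mono (Ioi_subset_Ioi hY) le_rfl))) ?_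
    filter_upwards [ae_restrict_mem measurableSet_Ioi] with x hx
    have h1 := hX x ((le_max_left X 0).trans (mem_Ioi.1 hx).le)
    rw [Real.dist_eq] at h1
    have h2 : |S x / Real.exp x| ≤ |a| + 1 := by
      have := abs_sub_abs_le_abs_sub (S x / Real.exp x) a
      linarith
    have h3 : Real.exp (-(σ * x)) * S x = Real.exp (-((σ - 1) * x)) * (S x / Real.exp x) := by
      rw [div_eq_mul_inv, ← Real.exp_neg, mul_left_comm, ← Real.exp_add, mul_comm]
      ring_nf
    rw [h3, norm_mul, Real.norm_of_nonneg (Real.exp_pos _).le]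
    exact mul_le_mul_of_nonneg_left h2 (Real.exp_pos _).le

/-! ### Letting σ → 1 under the integral sign. -/

/-- Monotone convergence for Abel means of a function bounded below against a kernel. -/
theorem integrableOn_of_tendsto_exp_mul {r K : ℝ → ℝ} {X C l : ℝ} (hX : 0 ≤ X)
    (hC : ∀ x, X ≤ x → -C ≤ r x) (hK : Integrable K) (hK0 : ∀ x, 0 ≤ K x)
    (hloc : IntegrableOn (fun x => r x * K x) (Ioc 0 X))
    (hi : ∀ σ : ℝ, 1 < σ →
      IntegrableOn (fun x => Real.exp (-((σ - 1) * x)) * (r x * K x)) (Ioi 0))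
    (hlim : Tendsto (fun σ : ℝ => ∫ x in Ioi (0 : ℝ), Real.exp (-((σ - 1) * x)) * (r x * K x))
      (𝓝[>] 1) (𝓝 l)) :
    IntegrableOn (fun x => r x * K x) (Ioi 0) := by
  have hsub : Ioi X ⊆ Ioi 0 := Ioi_subset_Ioi hX
  have hCK : IntegrableOn (fun x => C * K x) (Ioi X) := (hK.const_mul C).integrableOn
  set g : ℝ → ℝ := fun x => r x * K x + C * K x
  have hg0 : ∀ x, X ≤ x → 0 ≤ g x := fun x hx => by
    simp only [g, ← add_mul]
    exact mul_nonneg (by linarith [hC x hx]) (hK0 x)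
  have hgi : ∀ σ : ℝ, 1 < σ → IntegrableOn (fun x => Real.exp (-((σ - 1) * x)) * g x) (Ioi X) := by
    intro σ hσ
    refine (((hi σ hσ).mono_set hsub).add
      (IntegrableOn.exp_mul measurableSet_Ioi hsub hCK hσ)).congr (.of_forall fun x => ?_)
    simp only [g, Pi.add_apply, mul_add]
  have hglim := (hlim.sub (tendsto_integral_exp_mul measurableSet_Ioc Ioc_subset_Ioi_self hloc)).add
    (tendsto_integral_exp_mul measurableSet_Ioi hsub hCK)
  set m := l - (∫ x in Ioc 0 X, r x * K x) + ∫ x in Ioi X, C * K x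
  have hglim' : Tendsto (fun σ : ℝ => ∫ x in Ioi X, Real.exp (-((σ - 1) * x)) * g x)
      (𝓝[>] 1) (𝓝 m) := by
    refine hglim.congr' ?_
    filter_upwards [self_mem_nhdsWithin] with σ hσ
    have h1 := IntegrableOn.exp_mul measurableSet_Ioc Ioc_subset_Ioi_self hloc hσ
    have h2 := (hi σ hσ).mono_set hsub
    rw [← Ioc_union_Ioi_eq_Ioi hX, setIntegral_union (Ioc_disjoint_Ioi le_rfl)
      measurableSet_Ioi h1 h2, add_sub_cancel_left, ← integral_add h2
      (IntegrableOn.exp_mul measurableSet_Ioi hsub hCK hσ)]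
    simp only [g, mul_add]
  let v : ℕ → ℝ := fun n => 1 + 1 / ((n : ℝ) + 1)
  have hv1 : ∀ n, 1 < v n := fun n => by
    have : 0 < 1 / ((n : ℝ) + 1) := by positivity
    simp only [v]
    linarith
  have hv0 : Tendsto v atTop (𝓝 1) := by
    have := (tendsto_one_div_add_atTop_nhds_zero_nat (𝕜 := ℝ)).const_add 1
    rwa [add_zero] at this
  have hv : Tendsto v atTop (𝓝[>] 1) :=
    tendsto_nhdsWithin_iff.2 ⟨hv0, .of_forall hv1⟩
  have hgint : IntegrableOn g (Ioi X) := by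
    -- Fatou along σ = `v n`: the damped functions are nonnegative and converge pointwise to g, and
    -- their integrals converge to the finite number m.
    refine integrable_of_tendsto (G := fun n x => Real.exp (-((v n - 1) * x)) * g x)
      (.of_forall fun x => ?_) (fun n => (hgi _ (hv1 n)).aestronglyMeasurable) ?_
    · have : Continuous fun σ : ℝ => Real.exp (-((σ - 1) * x)) * g x := by fun_prop
      have h1 := (this.tendsto 1).comp hv0
      rwa [sub_self, zero_mul, neg_zero, Real.exp_zero, one_mul] at h1
    · have h1 : ∀ n, ∫⁻ x in Ioi X, ‖Real.exp (-((v n - 1) * x)) * g x‖ₑ =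
          ENNReal.ofReal (∫ x in Ioi X, Real.exp (-((v n - 1) * x)) * g x) := by
        intro n
        rw [← ofReal_integral_norm_eq_lintegral_enorm (hgi _ (hv1 n))]
        congr 1
        refine setIntegral_congr_fun measurableSet_Ioi fun x hx => ?_
        exact Real.norm_of_nonneg (mul_nonneg (Real.exp_pos _).le (hg0 x (mem_Ioi.1 hx).le))
      simp only [h1]
      have h2 : Tendsto (fun n => ENNReal.ofReal
          (∫ x in Ioi X, Real.exp (-((v n - 1) * x)) * g x)) atTop (𝓝 (ENNReal.ofReal m)) :=
        ENNReal.tendsto_ofReal (hglim'.comp hv)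
      rw [h2.liminf_eq]
      exact ENNReal.ofReal_ne_top
  rw [← Ioc_union_Ioi_eq_Ioi hX]
  refine hloc.union ((hgint.sub hCK).congr (.of_forall fun x => ?_))
  simp [g]

namespace IsNonnegKernel

variable {F : ℝ → ℝ}

/-- Boundary behaviour of Abel means, rephrased for the convolution integrals themselves. -/
theorem tendsto_integral_of_abel (hF : IsNonnegKernel F) {r : ℝ → ℝ}
    (hr : LocallyIntegrableOn r (Ici 0)) {X C : ℝ} (hX : 0 ≤ X) (hC : ∀ x, X ≤ x → -C ≤ r x)
    (hi : ∀ σ : ℝ, 1 < σ → IntegrableOn (fun x => Real.exp (-((σ - 1) * x)) * r x) (Ioi 0))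
    {lam : ℝ} (hl : 0 < lam) {J : ℝ → ℂ}
    (hJ : ∀ᶠ h : ℝ in atTop, Tendsto (fun σ : ℝ => ((∫ x in Ioi (0 : ℝ),
      Real.exp (-((σ - 1) * x)) * r x * scaledKernel F lam h x : ℝ) : ℂ)) (𝓝[>] 1) (𝓝 (J h)))
    (hJ0 : Tendsto J atTop (𝓝 0)) {Y : ℝ} (hY : 0 ≤ Y) :
    (∀ᶠ h in atTop, IntegrableOn (fun x => r x * scaledKernel F lam h x) (Ioi Y)) ∧
      Tendsto (fun h => ∫ x in Ioi Y, r x * scaledKernel F lam h x) atTop (𝓝 0) := by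
  have hloc : ∀ Z, IntegrableOn r (Ioc 0 Z) := fun Z =>
    (hr.integrableOn_compact_subset Icc_subset_Ici_self isCompact_Icc).mono_set Ioc_subset_Icc_self
  have key : ∀ᶠ h in atTop, IntegrableOn (fun x => r x * scaledKernel F lam h x) (Ioi 0) ∧
      J h = ((∫ x in Ioi (0 : ℝ), r x * scaledKernel F lam h x : ℝ) : ℂ) := by
    filter_upwards [hJ] with h hh
    simp only [mul_assoc] at hh
    have hre := (Complex.continuous_re.tendsto _).comp hh
    have hint : IntegrableOn (fun x => r x * scaledKernel F lam h x) (Ioi 0) := by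
      refine integrableOn_of_tendsto_exp_mul hX hC (integrable_scaledKernel hF.integrable hl h)
        (hF.scaledKernel_nonneg hl h) (hF.integrable_mul_scaledKernel (hloc X) hl h)
        (fun σ hσ => ?_) hre
      simpa only [mul_assoc] using! hF.integrable_mul_scaledKernel (hi σ hσ) hl h
    -- With integrability known, domination computes the Abel limit, which must therefore be J h.
    refine ⟨hint, tendsto_nhds_unique hh ?_⟩
    exact (Complex.continuous_ofReal.tendsto _).comp
      (tendsto_integral_exp_mul measurableSet_Ioi subset_rfl hint)
  refine ⟨key.mono fun h hh => hh.1.mono_set (Ioi_subset_Ioi hY), ?_⟩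
  have h0 : Tendsto (fun h => ∫ x in Ioi (0 : ℝ), r x * scaledKernel F lam h x) atTop (𝓝 0) := by
    refine ((Complex.continuous_re.tendsto 0).comp hJ0).congr' ?_
    filter_upwards [key] with h hh
    simp only [Function.comp_apply, hh.2, Complex.ofReal_re]
  -- The part over (0, Y] vanishes as h → ∞, so the lower endpoint may be moved freely.
  have h1 := h0.sub (hF.tendsto_integral_mul_scaledKernel (hloc Y) hl)
  rw [sub_zero] at h1
  refine h1.congr' ?_
  filter_upwards [key] with h hh
  rw [← Ioc_union_Ioi_eq_Ioi hY, setIntegral_union (Ioc_disjoint_Ioi le_rfl)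
    measurableSet_Ioi (hF.integrable_mul_scaledKernel (hloc Y) hl h)
    (hh.1.mono_set (Ioi_subset_Ioi hY)), add_sub_cancel_left]

end IsNonnegKernel

/-! ### The Tauberian argument: boundedness, then convergence. -/

/-- The factor e^{-u} comes from normalizing at x + u instead of x. It can be discarded only once an
upper bound on e^{-x}S(x) is known, so the proof of that bound has to work with it. -/
theorem LogLinearlySlowlyDecreasing.normalized {S : ℝ → ℝ} (h : LogLinearlySlowlyDecreasing S)
    {ε : ℝ} (hε : 0 < ε) : ∃ δ : ℝ, 0 < δ ∧ ∃ X : ℝ, ∀ x, X ≤ x → ∀ u, 0 ≤ u → u ≤ δ →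
      Real.exp (-u) * (S x * Real.exp (-x) - ε) ≤ S (x + u) * Real.exp (-(x + u)) := by
  obtain ⟨δ, hδ, X, hX⟩ := h ε hε
  refine ⟨δ, hδ, X, fun x hx u hu hu' => ?_⟩
  have h1 := hX x hx u hu hu'
  have h2 : S (x + u) * Real.exp (-(x + u)) =
      Real.exp (-u) * (S x * Real.exp (-x) + (S (x + u) - S x) / Real.exp x) := by
    rw [neg_add, Real.exp_add, Real.exp_neg x]
    ring
  rw [h2]
  exact mul_le_mul_of_nonneg_left (by linarith) (Real.exp_pos _).le

/-- For bounded normalizations, log-linear slow decrease is ordinary slow decrease. -/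
theorem LogLinearlySlowlyDecreasing.normalized_of_bounded {S : ℝ → ℝ}
    (h : LogLinearlySlowlyDecreasing S) {Y B : ℝ}
    (hB : ∀ x, Y ≤ x → S x * Real.exp (-x) ≤ B) {ε : ℝ} (hε : 0 < ε) :
    ∃ δ : ℝ, 0 < δ ∧ ∃ X : ℝ, ∀ x, X ≤ x → ∀ u, 0 ≤ u → u ≤ δ →
      S x * Real.exp (-x) - ε ≤ S (x + u) * Real.exp (-(x + u)) := by
  obtain ⟨δ, hδ, X, hX⟩ := h.normalized (half_pos hε)
  have hB1 : 0 < |B| + 1 := by positivity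
  refine ⟨min δ (ε / 2 / (|B| + 1)), by positivity, max X Y, fun x hx u hu hu' => ?_⟩
  have h1 := hX x ((le_max_left _ _).trans hx) u hu (hu'.trans (min_le_left _ _))
  have h2 := hB x ((le_max_right _ _).trans hx)
  have h3 : u * (|B| + 1) ≤ ε / 2 := (le_div_iff₀ hB1).1 (hu'.trans (min_le_right _ _))
  have h4 : 1 - u ≤ Real.exp (-u) := by linarith [Real.add_one_le_exp (-u)]
  have h5 : Real.exp (-u) ≤ 1 := Real.exp_le_one_iff.2 (by linarith)
  have h6 : (1 - Real.exp (-u)) * (S x * Real.exp (-x) - ε / 2) ≤ u * (|B| + 1) :=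
    calc (1 - Real.exp (-u)) * (S x * Real.exp (-x) - ε / 2)
        ≤ (1 - Real.exp (-u)) * (|B| + 1) :=
          mul_le_mul_of_nonneg_left (by linarith [le_abs_self B]) (by linarith)
      _ ≤ u * (|B| + 1) := mul_le_mul_of_nonneg_right (by linarith) hB1.le
  linarith

namespace IsNonnegKernel

variable {F : ℝ → ℝ}

/-- The kernel may vanish at 0, so the centre u of the window is left arbitrary. -/
theorem exists_lower_bound_on_interval (hF : IsNonnegKernel F) :
    ∃ u η c, 0 < η ∧ 0 < c ∧ ∀ y, |y - u| ≤ η → c ≤ F y := by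
  obtain ⟨u, hu⟩ := hF.exists_pos
  obtain ⟨η, hη, h⟩ := Metric.eventually_nhds_iff.1
    ((hF.continuous.tendsto u).eventually (eventually_gt_nhds (half_lt_self hu)))
  refine ⟨u, η / 2, F u / 2, half_pos hη, half_pos hu, fun y hy => (h ?_).le⟩
  rw [Real.dist_eq]
  linarith

/-- A large value at x persists on [x, x + ρ], where a suitably translated kernel is at least λc.
The rest of the convolution is bounded below through -C, so a convolution below 1 caps the value. -/
theorem exists_upper_bound (hF : IsNonnegKernel F) {S : ℝ → ℝ} {a : ℝ}
    (hS : LogLinearlySlowlyDecreasing S) {X C : ℝ} (hC0 : 0 ≤ C)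
    (hC : ∀ x, X ≤ x → -C ≤ S x * Real.exp (-x) - a) {lam : ℝ} (hl : 0 < lam)
    (hi : ∀ᶠ h in atTop,
      IntegrableOn (fun x => (S x * Real.exp (-x) - a) * scaledKernel F lam h x) (Ioi X))
    (hlim : Tendsto (fun h => ∫ x in Ioi X, (S x * Real.exp (-x) - a) * scaledKernel F lam h x)
      atTop (𝓝 0)) :
    ∃ Y B : ℝ, ∀ x, Y ≤ x → S x * Real.exp (-x) ≤ B := by
  obtain ⟨u, η, c, hη, hc, hFc⟩ := hF.exists_lower_bound_on_interval
  obtain ⟨δ, hδ, Z, hZ⟩ := hS.normalized one_pos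
  -- The window must fit both slow decrease (δ) and the set where F ≥ c, of length 2η/λ after
  -- scaling.
  set ρ := min δ (2 * η / lam)
  have hρ : 0 < ρ := by positivity
  have hA := hF.integral_pos
  set A := ∫ x, F x
  set M := (1 + C * A) / (ρ * (lam * c))
  have hM : 0 ≤ M := by positivity
  have hev : ∀ᶠ h in atTop,
      IntegrableOn (fun x => (S x * Real.exp (-x) - a) * scaledKernel F lam h x) (Ioi X) ∧
      ∫ x in Ioi X, (S x * Real.exp (-x) - a) * scaledKernel F lam h x < 1 :=
    hi.and (hlim.eventually (eventually_lt_nhds one_pos))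
  have hshift : Tendsto (fun x : ℝ => x + -((u - η) / lam)) atTop atTop :=
    tendsto_atTop_add_const_right _ _ tendsto_id
  obtain ⟨Y, hY⟩ := eventually_atTop.1
    ((hshift.eventually hev).and ((eventually_gt_atTop X).and (eventually_ge_atTop Z)))
  refine ⟨Y, max 1 (Real.exp δ * (M + a - C) + 1), fun x hx => ?_⟩
  obtain ⟨⟨hxi, hx1⟩, hxX, hxZ⟩ := hY x hx
  -- With this h the point x corresponds to u - η, the left end of the interval where F ≥ c.
  set h := x + -((u - η) / lam) with hh
  -- In the remaining case the factor after e^{-(y-x)} is nonnegative, so e^{-(y-x)} may be lowered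
  -- to e^{-δ}; then m bounds r + C from below on the window.
  by_cases hτ : S x * Real.exp (-x) ≤ 1
  · exact hτ.trans (le_max_left _ _)
  refine le_max_of_le_right ?_
  push Not at hτ
  set m := Real.exp (-δ) * (S x * Real.exp (-x) - 1) - a + C with hm
  suffices hmM : m ≤ M by
    have h1 : Real.exp (-δ) * (S x * Real.exp (-x) - 1) ≤ M + a - C := by linarith
    have h2 := mul_le_mul_of_nonneg_left h1 (Real.exp_pos δ).le
    rw [← mul_assoc, ← Real.exp_add, add_neg_cancel, Real.exp_zero, one_mul] at h2
    linarith
  by_cases hm0 : m ≤ 0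
  · exact hm0.trans hM
  push Not at hm0
  have hKi := integrable_scaledKernel hF.integrable hl h
  have hK0 := hF.scaledKernel_nonneg hl h
  have hsum : IntegrableOn (fun y => (S y * Real.exp (-y) - a) * scaledKernel F lam h y +
      C * scaledKernel F lam h y) (Ioi X) := hxi.add (hKi.const_mul C).integrableOn
  have hsub : Icc x (x + ρ) ⊆ Ioi X := fun y hy => hxX.trans_le hy.1
  have hup : ∫ y in Ioi X, ((S y * Real.exp (-y) - a) * scaledKernel F lam h y +
      C * scaledKernel F lam h y) ≤ 1 + C * A := by
    rw [integral_add hxi (hKi.const_mul C).integrableOn]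
    refine add_le_add hx1.le ?_
    calc ∫ y in Ioi X, C * scaledKernel F lam h y ≤ ∫ y, C * scaledKernel F lam h y :=
          setIntegral_le_integral (hKi.const_mul C)
            (.of_forall fun y => mul_nonneg hC0 (hK0 y))
      _ = C * A := by rw [integral_const_mul, integral_scaledKernel F hl h]
  have hlow : ρ * (m * (lam * c)) ≤ ∫ y in Ioi X,
      ((S y * Real.exp (-y) - a) * scaledKernel F lam h y + C * scaledKernel F lam h y) := by
    calc ρ * (m * (lam * c)) = ∫ y in Icc x (x + ρ), m * (lam * c) := by
          simp [hρ.le]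
      _ ≤ ∫ y in Icc x (x + ρ), ((S y * Real.exp (-y) - a) * scaledKernel F lam h y +
            C * scaledKernel F lam h y) := by
          refine setIntegral_mono_on (integrableOn_const (by simp))
            (hsum.mono_set hsub) measurableSet_Icc fun y hy => ?_
          have hyδ : y - x ≤ δ := by linarith [hy.2, min_le_left δ (2 * η / lam)]
          have hyη : lam * (y - x) ≤ 2 * η := by
            have : y - x ≤ 2 * η / lam := by linarith [hy.2, min_le_right δ (2 * η / lam)]
            rw [mul_comm]
            exact (le_div_iff₀ hl).1 this
          have hyx : 0 ≤ y - x := by linarith [hy.1]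
          have h1 := hZ x hxZ (y - x) hyx hyδ
          rw [add_sub_cancel] at h1
          have h2 : Real.exp (-δ) ≤ Real.exp (-(y - x)) := Real.exp_le_exp.2 (by linarith)
          have h3 := mul_le_mul_of_nonneg_right h2 (sub_nonneg.2 hτ.le)
          have h4 : m ≤ S y * Real.exp (-y) - a + C := by linarith
          have h5 : lam * (y - h) - u = lam * (y - x) - η := by
            rw [hh]
            field_simp
            ring
          have h6 : lam * c ≤ scaledKernel F lam h y := by
            refine mul_le_mul_of_nonneg_left (hFc _ ?_) hl.le
            rw [h5, abs_le]
            constructor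
            · linarith [mul_nonneg hl.le hyx]
            · linarith
          rw [← add_mul]
          exact mul_le_mul h4 h6 (by positivity) (hm0.le.trans h4)
      _ ≤ _ := by
          refine setIntegral_mono_set hsum ?_ hsub.eventuallyLE
          filter_upwards [ae_restrict_mem measurableSet_Ioi] with y hy
          rw [← add_mul]
          exact mul_nonneg (by linarith [hC y (mem_Ioi.1 hy).le]) (hK0 y)
  rw [le_div_iff₀ (by positivity)]
  calc m * (ρ * (lam * c)) = ρ * (m * (lam * c)) := by ring
    _ ≤ 1 + C * A := hlow.trans hup

/-- This is where arbitrarily large λ enters: the kernel mass outside a fixed window around h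
becomes negligible. -/
theorem tendsto_integral_tail (hF : IsNonnegKernel F) {ρ : ℝ} (hρ : 0 < ρ) :
    Tendsto (fun lam : ℝ => ∫ u, {u : ℝ | lam * ρ < |u|}.indicator F u) atTop (𝓝 0) := by
  have hms : ∀ lam : ℝ, MeasurableSet {u : ℝ | lam * ρ < |u|} := fun lam =>
    measurableSet_lt measurable_const continuous_abs.measurable
  rw [← integral_zero ℝ ℝ (μ := volume)]
  refine tendsto_integral_filter_of_dominated_convergence F
    (.of_forall fun lam => (hF.integrable.indicator (hms lam)).aestronglyMeasurable)
    (.of_forall fun lam => .of_forall fun u => ?_) hF.integrable (.of_forall fun u => ?_)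
  · refine (norm_indicator_le_norm_self F u).trans ?_
    rw [Real.norm_of_nonneg (hF.nonneg u)]
  · refine tendsto_const_nhds.congr' ?_
    filter_upwards [eventually_ge_atTop (|u| / ρ)] with lam hlam
    rw [indicator_of_notMem]
    exact not_lt.2 ((div_le_iff₀ hρ).1 hlam)

/-- Lower bound for a convolution integral of a function that is large on a window. -/
theorem window_lower_bound (hF : IsNonnegKernel F) {w : ℝ → ℝ} {X B ε ρ h lam : ℝ}
    (hl : 0 < lam) (hB : 0 ≤ B) (hb : ∀ y, X < y → -B ≤ w y)
    (hw : ∀ y, |y - h| ≤ ρ → X < y ∧ ε ≤ w y)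
    (hi : IntegrableOn (fun y => w y * scaledKernel F lam h y) (Ioi X)) :
    ε * (∫ u, F u) - (B + ε) * ∫ u, {u : ℝ | lam * ρ < |u|}.indicator F u ≤
      ∫ y in Ioi X, w y * scaledKernel F lam h y := by
  set T := {u : ℝ | lam * ρ < |u|}.indicator F with hT
  have hTi : Integrable T := hF.integrable.indicator
    (measurableSet_lt measurable_const continuous_abs.measurable)
  have hKi := integrable_scaledKernel hF.integrable hl h
  have hKTi := integrable_scaledKernel hTi hl h
  have hK0 := hF.scaledKernel_nonneg hl h
  rw [← integral_scaledKernel F hl h, ← integral_scaledKernel T hl h, ← integral_const_mul,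
    ← integral_const_mul, ← integral_sub (hKi.const_mul _) (hKTi.const_mul _),
    ← integral_indicator measurableSet_Ioi]
  refine integral_mono ((hKi.const_mul _).sub (hKTi.const_mul _))
    ((integrable_indicator_iff measurableSet_Ioi).2 hi) fun y => ?_
  have habs : |lam * (y - h)| = lam * |y - h| := by rw [abs_mul, abs_of_pos hl]
  -- Inside the window the tail kernel vanishes and w ≥ ε; outside, it equals the full kernel and ε
  -- - (B + ε) = -B.
  by_cases hy : |y - h| ≤ ρ
  · have hT0 : scaledKernel T lam h y = 0 := by
      rw [scaledKernel, hT, indicator_of_notMem, mul_zero]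
      rw [mem_ofPred_eq, habs, not_lt]
      exact mul_le_mul_of_nonneg_left hy hl.le
    obtain ⟨h1, h2⟩ := hw y hy
    rw [indicator_of_mem (mem_Ioi.2 h1)]
    simp only [hT0, mul_zero, sub_zero]
    exact mul_le_mul_of_nonneg_right h2 (hK0 y)
  · have hT1 : scaledKernel T lam h y = scaledKernel F lam h y := by
      rw [scaledKernel, hT, indicator_of_mem, scaledKernel]
      rw [mem_ofPred_eq, habs]
      exact mul_lt_mul_of_pos_left (not_le.1 hy) hl
    simp only [hT1]
    rw [← sub_mul, show ε - (B + ε) = -B by ring]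
    by_cases hyX : X < y
    · rw [indicator_of_mem (mem_Ioi.2 hyX)]
      exact mul_le_mul_of_nonneg_right (hb y hyX) (hK0 y)
    · rw [indicator_of_notMem (by simpa using hyX)]
      linarith [mul_nonneg hB (hK0 y)]

/-- A Tauberian theorem for bounded slowly decreasing functions. -/
theorem tendsto_zero_of_slowlyDecreasing (hF : IsNonnegKernel F) {r : ℝ → ℝ} {X B lam₀ : ℝ}
    (hb : ∀ x, X ≤ x → |r x| ≤ B)
    (hsd : ∀ ε : ℝ, 0 < ε → ∃ δ : ℝ, 0 < δ ∧ ∃ Z : ℝ, ∀ x, Z ≤ x → ∀ u, 0 ≤ u → u ≤ δ →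
      r x - ε ≤ r (x + u))
    (hT : ∀ lam : ℝ, lam₀ ≤ lam →
      (∀ᶠ h in atTop, IntegrableOn (fun x => r x * scaledKernel F lam h x) (Ioi X)) ∧
        Tendsto (fun h => ∫ x in Ioi X, r x * scaledKernel F lam h x) atTop (𝓝 0)) :
    Tendsto r atTop (𝓝 0) := by
  have hB : 0 ≤ B := (abs_nonneg _).trans (hb X le_rfl)
  have hA := hF.integral_pos
  rw [Metric.tendsto_atTop]
  intro ε' hε'
  obtain ⟨ε, hε, hεε'⟩ : ∃ ε : ℝ, 0 < ε ∧ 2 * ε < ε' := ⟨ε' / 4, by positivity, by linarith⟩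
  obtain ⟨δ, hδ, Z, hZ⟩ := hsd ε hε
  have htail := (hF.tendsto_integral_tail (half_pos hδ)).const_mul (B + ε)
  rw [mul_zero] at htail
  -- For this λ the tail costs less than half of ε∫F, so a window of values ≥ ε makes the
  -- convolution exceed ε∫F/2, while for large h it is smaller.
  obtain ⟨lam, hlt, hl0, hl⟩ :=
    ((htail.eventually (eventually_lt_nhds (half_pos (mul_pos hε hA)))).and
      ((eventually_ge_atTop lam₀).and (eventually_gt_atTop 0))).exists
  obtain ⟨hTi, hTl⟩ := hT lam hl0
  obtain ⟨N, hN⟩ := eventually_atTop.1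
    (hTi.and (Metric.tendsto_nhds.1 hTl _ (half_pos (mul_pos hε hA))))
  refine ⟨max (max (Z + δ) (X + δ + 1)) (N + δ), fun x hx => ?_⟩
  have hxZ : Z + δ ≤ x := (le_max_left _ _).trans ((le_max_left _ _).trans hx)
  have hxX : X + δ + 1 ≤ x := (le_max_right _ _).trans ((le_max_left _ _).trans hx)
  have hxN : N + δ ≤ x := (le_max_right _ _).trans hx
  have hlow : -(2 * ε) ≤ r x := by
    by_contra! hcon
    -- A low value is inherited from the left: r(y) ≤ r(x) + ε < -ε for y in [x - δ, x], so the
    -- window ends at x.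
    obtain ⟨hi, hsmall⟩ := hN (x - δ / 2) (by linarith)
    rw [dist_zero_right, Real.norm_eq_abs, abs_lt] at hsmall
    have hi' : IntegrableOn (fun y => -r y * scaledKernel F lam (x - δ / 2) y) (Ioi X) := by
      simpa only [neg_mul] using! hi.neg
    have := hF.window_lower_bound (w := fun y => -r y) (X := X) (B := B) (ε := ε) (ρ := δ / 2)
      (h := x - δ / 2) hl hB
      (fun y hy => by linarith [le_abs_self (r y), hb y hy.le])
      (fun y hy => by
        rw [abs_le] at hy
        have h1 := hZ y (by linarith [hy.1]) (x - y) (by linarith [hy.2]) (by linarith [hy.1])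
        rw [add_sub_cancel] at h1
        exact ⟨by linarith [hy.1], by linarith⟩) hi'
    simp only [neg_mul, integral_neg] at this
    linarith [hsmall.1]
  have hup : r x ≤ 2 * ε := by
    by_contra! hcon
    -- A high value propagates to the right: r(y) ≥ r(x) - ε > ε on [x, x + δ], so the window starts
    -- at x.
    obtain ⟨hi, hsmall⟩ := hN (x + δ / 2) (by linarith)
    rw [dist_zero_right, Real.norm_eq_abs, abs_lt] at hsmall
    have := hF.window_lower_bound (X := X) (B := B) (ε := ε) (ρ := δ / 2)
      (h := x + δ / 2) hl hB
      (fun y hy => by linarith [neg_abs_le (r y), hb y hy.le])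
      (fun y hy => by
        rw [abs_le] at hy
        have h1 := hZ x (by linarith) (y - x) (by linarith [hy.1]) (by linarith [hy.2])
        rw [add_sub_cancel] at h1
        exact ⟨by linarith [hy.1], by linarith⟩) hi
    linarith [hsmall.2]
  rw [dist_zero_right, Real.norm_eq_abs]
  exact (abs_le.2 ⟨hlow, hup⟩).trans_lt hεε'

end IsNonnegKernel

/-! ### The two implications and the Fejér case. -/

theorem boundary_behaviour_of_tendsto {S : ℝ → ℝ} (hS : LocallyIntegrableOn S (Ici 0)) {a : ℝ}
    {φ : ℝ → ℂ} (hφ : Integrable φ) {F : ℝ → ℝ} (hF : IsNonnegKernel F)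
    (hFφ : ∀ x, angularFourier φ x = (F x : ℂ))
    (h : Tendsto (fun x : ℝ => S x / Real.exp x) atTop (𝓝 a)) {lam : ℝ} (hl : 0 < lam) :
    ∃ J : ℝ → ℂ, (∀ᶠ h : ℝ in atTop, Tendsto
      (fun σ : ℝ => ∫ t : ℝ, laplaceMinusPole S a ((σ : ℂ) + Complex.I * (t : ℂ)) *
        Complex.exp (Complex.I * (h : ℂ) * (t : ℂ)) * φ (t / lam)) (𝓝[>] 1) (𝓝 (J h))) ∧
      Tendsto J atTop (𝓝 0) := by
  obtain ⟨h1, h2⟩ := hF.tendsto_integral_of_tendsto_zero (locallyIntegrableOn_normalized hS a)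
    (tendsto_normalized_iff.1 h) hl
  refine ⟨fun h => ((∫ x in Ioi (0 : ℝ), (S x * Real.exp (-x) - a) * scaledKernel F lam h x : ℝ) :
    ℂ), .of_forall fun u => ?_, ?_⟩
  · have h3 := (Complex.continuous_ofReal.tendsto _).comp
      (tendsto_integral_exp_mul measurableSet_Ioi subset_rfl (h1 u))
    refine h3.congr' ?_
    filter_upwards [self_mem_nhdsWithin] with σ hσ
    rw [integral_laplaceMinusPole hS a hφ hFφ hl hσ (integrableOn_laplace_of_tendsto hS h hσ)]
    simp only [Function.comp_apply, mul_assoc]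
  · simpa using! (Complex.continuous_ofReal.tendsto 0).comp h2

theorem tendsto_of_boundary_behaviour {S : ℝ → ℝ} (hS : LocallyIntegrableOn S (Ici 0)) {a : ℝ}
    {φ : ℝ → ℂ} (hφ : Integrable φ) {F : ℝ → ℝ} (hF : IsNonnegKernel F)
    (hFφ : ∀ x, angularFourier φ x = (F x : ℂ)) (hsd : LogLinearlySlowlyDecreasing S)
    (hconv : ∀ s : ℂ, 1 < s.re → LaplaceConvergesAt S s) {lam₀ : ℝ} (hl₀ : 0 < lam₀)
    (hJ : ∀ lam : ℝ, lam₀ ≤ lam → ∃ J : ℝ → ℂ, (∀ᶠ h : ℝ in atTop, Tendsto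
      (fun σ : ℝ => ∫ t : ℝ, laplaceMinusPole S a ((σ : ℂ) + Complex.I * (t : ℂ)) *
        Complex.exp (Complex.I * (h : ℂ) * (t : ℂ)) * φ (t / lam)) (𝓝[>] 1) (𝓝 (J h))) ∧
      Tendsto J atTop (𝓝 0)) :
    Tendsto (fun x : ℝ => S x / Real.exp x) atTop (𝓝 a) := by
  obtain ⟨X, hX, C, hC, hSC⟩ := hsd.exists_lower_bound
  have habs : ∀ σ : ℝ, 1 < σ → IntegrableOn (fun x => Real.exp (-(σ * x)) * S x) (Ioi 0) :=
    fun σ hσ => integrableOn_laplace_of_converges hS hX hSC hσ (hconv σ (by simpa using hσ))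
  have hlow : ∀ x, X ≤ x → -(C + |a|) ≤ S x * Real.exp (-x) - a := fun x hx => by
    linarith [hSC x hx, le_abs_self a]
  have hT : ∀ lam : ℝ, lam₀ ≤ lam → ∀ Y : ℝ, 0 ≤ Y →
      (∀ᶠ h in atTop, IntegrableOn
        (fun x => (S x * Real.exp (-x) - a) * scaledKernel F lam h x) (Ioi Y)) ∧
      Tendsto (fun h => ∫ x in Ioi Y, (S x * Real.exp (-x) - a) * scaledKernel F lam h x)
        atTop (𝓝 0) := by
    intro lam hlam Y hY
    have hl := hl₀.trans_le hlam
    obtain ⟨J, hJ1, hJ2⟩ := hJ lam hlam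
    refine hF.tendsto_integral_of_abel (locallyIntegrableOn_normalized hS a) hX hlow
      (fun σ hσ => integrableOn_laplace_sub_exp a hσ (habs σ hσ)) hl ?_ hJ2 hY
    filter_upwards [hJ1] with h hh
    refine hh.congr' ?_
    filter_upwards [self_mem_nhdsWithin] with σ hσ
    exact integral_laplaceMinusPole hS a hφ hFφ hl hσ (habs σ hσ) h
  -- Boundedness needs only the single value λ₀; larger λ are used in the final limit.
  obtain ⟨Y, B, hB⟩ := hF.exists_upper_bound hsd (by positivity) hlow hl₀
    (hT lam₀ le_rfl X hX).1 (hT lam₀ le_rfl X hX).2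
  set Z := max X Y
  refine tendsto_normalized_iff.2 (hF.tendsto_zero_of_slowlyDecreasing
    (X := Z) (B := max (C + |a|) (B - a)) (fun x hx => ?_) (fun ε hε => ?_)
    fun lam hlam => hT lam hlam Z (hX.trans (le_max_left _ _)))
  · rw [abs_le]
    constructor
    · linarith [hlow x ((le_max_left _ _).trans hx), le_max_left (C + |a|) (B - a)]
    · linarith [hB x ((le_max_right _ _).trans hx), le_max_right (C + |a|) (B - a)]
  · obtain ⟨δ, hδ, W, hW⟩ := hsd.normalized_of_bounded hB hε
    exact ⟨δ, hδ, W, fun x hx u hu hu' => by linarith [hW x hx u hu hu']⟩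

theorem integral_mul_fejerMultiplier (g : ℝ → ℂ) {lam : ℝ} (hl : 0 < lam) :
    ∫ t : ℝ, g t * fejerMultiplier (t / lam) =
      ∫ t in (-lam)..lam, g t * ((1 - |t| / lam : ℝ) : ℂ) := by
  have hmem : ∀ t : ℝ, t / lam ∈ Icc (-1 : ℝ) 1 ↔ t ∈ Icc (-lam) lam := fun t => by
    rw [mem_Icc, mem_Icc, le_div_iff₀ hl, div_le_iff₀ hl, neg_one_mul, one_mul]
  rw [intervalIntegral.integral_of_le (by linarith), ← integral_Icc_eq_integral_Ioc,
    ← integral_indicator measurableSet_Icc]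
  refine integral_congr_ae (.of_forall fun t => ?_)
  by_cases ht : t ∈ Icc (-lam) lam
  · simp only [indicator_of_mem ht, fejerMultiplier, indicator_of_mem ((hmem t).2 ht),
      abs_div, abs_of_pos hl]
  · simp only [indicator_of_notMem ht, fejerMultiplier,
      indicator_of_notMem (fun h => ht ((hmem t).1 h)), mul_zero]

theorem mainTheorem3 :
    -- the exact theorem for a general multiplier
    (∀ (S : ℝ → ℝ) (a : ℝ) (φ : ℝ → ℂ),
      LocallyIntegrableOn S (Ici 0) volume →
      MemWienerAlgebraCompact φ → φ ≠ 0 → NonnegFourier φ →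
      (Tendsto (fun x : ℝ => S x / Real.exp x) atTop (𝓝 a) ↔
        LogLinearlySlowlyDecreasing S ∧
        (∀ s : ℂ, 1 < s.re → LaplaceConvergesAt S s) ∧
        ∃ lam₀ : ℝ, 0 < lam₀ ∧ ∀ lam : ℝ, lam₀ ≤ lam →
          ∃ J : ℝ → ℂ,
            (∀ᶠ h : ℝ in atTop,
              Tendsto
                (fun σ : ℝ => ∫ t : ℝ,
                  laplaceMinusPole S a ((σ : ℂ) + Complex.I * (t : ℂ)) *
                    Complex.exp (Complex.I * (h : ℂ) * (t : ℂ)) * φ (t / lam))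
                (𝓝[>] 1) (𝓝 (J h))) ∧
            Tendsto J atTop (𝓝 0))) ∧
    -- the Fejér multiplier is admissible
    (MemWienerAlgebraCompact fejerMultiplier ∧ fejerMultiplier ≠ 0 ∧
      NonnegFourier fejerMultiplier) ∧
    -- the resulting special case, with absolute convergence of the Laplace integral
    (∀ (S : ℝ → ℝ) (a : ℝ),
      LocallyIntegrableOn S (Ici 0) volume →
      (Tendsto (fun x : ℝ => S x / Real.exp x) atTop (𝓝 a) ↔
        LogLinearlySlowlyDecreasing S ∧
        (∀ s : ℂ, 1 < s.re →
          IntegrableOn (fun x : ℝ => Complex.exp (-(s * (x : ℂ))) * (S x : ℂ)) (Ioi 0) volume) ∧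
        ∃ lam₀ : ℝ, 0 < lam₀ ∧ ∀ lam : ℝ, lam₀ ≤ lam →
          ∃ J : ℝ → ℂ,
            (∀ᶠ h : ℝ in atTop,
              Tendsto
                (fun σ : ℝ => ∫ t in (-lam)..lam,
                  laplaceMinusPole S a ((σ : ℂ) + Complex.I * (t : ℂ)) *
                    Complex.exp (Complex.I * (h : ℂ) * (t : ℂ)) * ((1 - |t| / lam : ℝ) : ℂ))
                (𝓝[>] 1) (𝓝 (J h))) ∧
            Tendsto J atTop (𝓝 0))) := by
  refine ⟨fun S a φ hS hφ h0 hn => ?_, ⟨memWienerAlgebraCompact_fejerMultiplier,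
    fejerMultiplier_ne_zero, nonnegFourier_fejerMultiplier⟩, fun S a hS => ?_⟩
  · obtain ⟨F, hF, hFφ⟩ := exists_kernel hφ h0 hn
    -- The choice λ₀ = 1 is arbitrary: in this direction every λ > 0 works.
    refine ⟨fun h => ⟨logLinearlySlowlyDecreasing_of_tendsto h, fun s hs => ?_, 1, one_pos,
      fun lam hlam => boundary_behaviour_of_tendsto hS hφ.integrable hF hFφ h
        (one_pos.trans_le hlam)⟩, ?_⟩
    · exact ⟨_, tendsto_laplacePartial ((integrableOn_laplace_iff hS s).2
        (integrableOn_laplace_of_tendsto hS h hs))⟩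
    · rintro ⟨hsd, hconv, lam₀, hl₀, hJ⟩
      exact tendsto_of_boundary_behaviour hS hφ.integrable hF hFφ hsd hconv hl₀ hJ
  · obtain ⟨F, hF, hFφ⟩ := exists_kernel memWienerAlgebraCompact_fejerMultiplier
      fejerMultiplier_ne_zero nonnegFourier_fejerMultiplier
    constructor
    · intro h
      refine ⟨logLinearlySlowlyDecreasing_of_tendsto h, fun s hs =>
        (integrableOn_laplace_iff hS s).2 (integrableOn_laplace_of_tendsto hS h hs), 1, one_pos,
        fun lam hlam => ?_⟩
      have hl : 0 < lam := one_pos.trans_le hlam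
      simpa only [integral_mul_fejerMultiplier _ hl] using
        boundary_behaviour_of_tendsto hS integrable_fejerMultiplier hF hFφ h hl
    · rintro ⟨hsd, habs, lam₀, hl₀, hJ⟩
      -- Absolute convergence implies convergence, so the general converse applies.
      refine tendsto_of_boundary_behaviour hS integrable_fejerMultiplier hF hFφ hsd
        (fun s hs => ⟨_, tendsto_laplacePartial (habs s hs)⟩) hl₀ fun lam hlam => ?_
      simpa only [integral_mul_fejerMultiplier _ (hl₀.trans_le hlam)] using hJ lam hlam
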